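/- **Proposition 3.1 (bounded generation).** Let $0<\delta<\frac1{40}$, let $q_1,q_2,q_3$ be positive integers, and let $A\subset \mathrm{SL}_2(\mathbb Z/q_1\mathbb Z)\times \mathrm{SL}_2(\mathbb Z/q_2\mathbb Z)\times \mathrm{SL}_2(\mathbb Z/q_3\mathbb Z)$ be symmetric (that is, $A=A^{-1}$) with $|A|>(q_1q_2q_3)^{3-\delta}$. Then there are positive divisors $q_1'\mid q_1$, $q_2'\mid q_2$, $q_3'\mid q_3$ with $$q_1'q_2'q_3'<(q_1q_2q_3)^{96\delta}$$ such that $$A^{7200}\supset \Lambda(q_1')/\Lambda(q_1)\times \Lambda(q_2')/\Lambda(q_2)\times \Lambda(q_3')/\Lambda(q_3).$$ Here $A^{k}=\{a_1a_2\cdots a_k : a_1,\dots,a_k\in A\}$ is the $k$-fold product set, $\Lambda(n)$ is the kernel of the reduction map $\mathrm{SL}_2(\mathbb Z)\to \mathrm{SL}_2(\mathbb Z/n\mathbb Z)$, and, for $q'\mid q$, $\Lambda(q')/\Lambda(q)$ is regarded as a subgroup of $\mathrm{SL}_2(\mathbb Z/q\mathbb Z)$ through reduction modulo $q$ (it consists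 of the matrices congruent to the identity modulo $q'$). -/

import Mathlib

open scoped Pointwise MatrixGroups

/-- The finite principal congruence subgroup `Λ(q') / Λ(q) = SL₂(q'ℤ/qℤ)` of `SL₂(ℤ/qℤ)`, where
`Λ = SL₂(ℤ)` and `Λ(n) = CongruenceSubgroup.Gamma n` is the kernel of reduction mod `n`: it is
the image of `Λ(q')` under reduction mod `q`.  It is used for `q' ∣ q`. -/
def principalCongruence (q' q : ℕ) : Subgroup SL(2, ZMod q) :=
  (CongruenceSubgroup.Gamma q').map
    (Matrix.SpecialLinearGroup.map (n := Fin 2) (Int.castRingHom (ZMod q)))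

/-! Write `Q = q₁q₂q₃` and `K = Q ^ δ`. Since `SL₂` of the product ring `R = ∏ ℤ/qᵢ` has at most `Q
^ 3` elements, `A` has density more than `1/K`. By pigeonhole on translates, `A⁻¹A = A²` then meets
every subgroup in a proportion at least `1/K`. Apply this to the diagonal torus, giving a dense set
`X` of units, and to the upper unipotents, giving a dense set `B ⊆ R`.

Conjugating a unipotent by a torus element multiplies its entry by `t²`, so `A^16` contains the
unipotents with entry `(t² - t'²)(b - b₀)`. A sum-product argument shows that 90 such entries add up
to every multiple of some `D = de` of size at most `K^47` (`exists_sum_eq`). To this end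
`exists_density_increment` restricts the squares of `X` to a class modulo `d`, and `B` to a class
modulo `e`, inside which they no longer concentrate. A bilinear character sum bound
(`norm_sum_char_le`) then makes the trivial frequencies dominate in the Fourier count. The indices
`d` and `e` are powers of `K` because squares modulo `d` have few roots (`card_sq_eq_one_le`,
`card_divisors_sq_mul_le`).

Hence `A^1440` contains the upper unipotents with entries in `D·R` and, by the inverse transpose
automorphism, the lower ones with entries in `D'·R`. By stable range one, each matrix congruent to
`1` modulo `DD'` is a product of five of these (`eq_lower_upper_lower_upper_lower`), and `5 · 1440 =
7200`. If `K < 2`, then `A` is more than half of the group and `A² = G`. -/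

/-! ### Pigeonhole in finite groups. -/

section FiniteGroups

variable {G H : Type*} [Group G] [Group H] [Finite G] [Finite H]

/-- A subset `A` of a finite group meets some translate of the image of `f : H →* G` in at least its
average share, so `A⁻¹ * A` contains the image of at least `|A||H| / |G|` elements of `H`. -/
theorem ncard_mul_card_le_preimage (f : H →* G) (A : Set G) :
    A.ncard * Nat.card H ≤ {h | f h ∈ A⁻¹ * A}.ncard * Nat.card G := by
  classical
  have := Fintype.ofFinite G
  have := Fintype.ofFinite H
  set S : Finset (G × H) := A.toFinset ×ˢ Finset.univ
  have hS : S.card = A.ncard * Nat.card H := by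
    rw [Finset.card_product, Set.ncard_eq_toFinset_card', Nat.card_eq_fintype_card,
      Finset.card_univ]
  rw [← hS, Nat.card_eq_fintype_card]
  -- Count `A × H` by the fibres of `(a, h) ↦ a * f h`: if `a * f h = a₀ * f h₀` then `a₀⁻¹ * a = f
  -- (h₀ * h⁻¹)`, so `h ↦ h₀ * h⁻¹` embeds a fibre in the set to be bounded.
  refine (Finset.card_le_mul_card_image (f := fun p : G × H => p.1 * f p.2) S
    ({h | f h ∈ A⁻¹ * A}.ncard) ?_).trans (Nat.mul_le_mul_left _ (Finset.card_le_univ _))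
  intro g hg
  obtain ⟨⟨a₀, h₀⟩, hS₀, rfl⟩ := Finset.mem_image.1 hg
  rw [Set.ncard_eq_toFinset_card']
  refine Finset.card_le_card_of_injOn (fun p => h₀ * p.2⁻¹) ?_ ?_
  · rintro ⟨a, h⟩ hp
    simp only [S, Finset.coe_filter, Finset.mem_product, Set.mem_toFinset, Finset.mem_univ,
      and_true, Set.mem_ofPred_eq] at hp hS₀
    simp only [Set.coe_toFinset, Set.mem_ofPred_eq]
    refine Set.mem_mul.2 ⟨a₀⁻¹, Set.inv_mem_inv.2 hS₀, a, hp.1, ?_⟩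
    rw [map_mul, map_inv, inv_mul_eq_iff_eq_mul, ← mul_assoc, eq_mul_inv_iff_mul_eq]
    exact hp.2
  · rintro ⟨a, h⟩ hp ⟨a', h'⟩ hp' he
    simp only [S, Finset.coe_filter, Finset.mem_product, Set.mem_toFinset, Finset.mem_univ,
      and_true, Set.mem_ofPred_eq] at hp hp'
    have : h = h' := by simpa using he
    subst this
    have := hp.2.trans hp'.2.symm
    simpa using this

/-- Two sets of more than half the size, `A` and `g * A`, must intersect. -/
theorem mul_inv_eq_univ_of_card_lt {A : Set G} (h : Nat.card G < 2 * A.ncard) :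
    A * A⁻¹ = Set.univ := by
  refine Set.eq_univ_of_forall fun g => ?_
  have hfin : ∀ s : Set G, s.Finite := fun s => s.toFinite
  have hinj : ((fun a => g * a) '' A).ncard = A.ncard :=
    Set.ncard_image_of_injective _ fun a b hab => by simpa using hab
  have : ¬ Disjoint A ((fun a => g * a) '' A) := by
    intro hd
    have h1 := Set.ncard_union_eq hd (hfin _) (hfin _)
    have h2 := Set.ncard_le_card (A ∪ (fun a => g * a) '' A)
    omega
  obtain ⟨x, hx, a, ha, rfl⟩ := Set.not_disjoint_iff.1 this
  exact ⟨_, hx, a⁻¹, Set.inv_mem_inv.2 ha, by simp⟩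

end FiniteGroups

/-! ### Product sets of a symmetric set. -/

section Powers

variable {G : Type*} [Group G]

theorem inv_pow_eq_self {A : Set G} (hA : A⁻¹ = A) (n : ℕ) : (A ^ n)⁻¹ = A ^ n := by
  rw [← inv_pow, hA]

theorem mul_mem_pow_add {A : Set G} {m n : ℕ} {g h : G} (hg : g ∈ A ^ m) (hh : h ∈ A ^ n) :
    g * h ∈ A ^ (m + n) := by
  rw [pow_add]
  exact Set.mul_mem_mul hg hh

end Powers

/-! ### Unipotents, torus and factorization in `SL₂`. -/

namespace Matrix.SpecialLinearGroup

variable {R : Type*} [CommRing R]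

/-- Upper unipotent matrices. -/
def upper (x : R) : SL(2, R) := ⟨!![1, x; 0, 1], by simp [Matrix.det_fin_two]⟩

/-- Lower unipotent matrices. -/
def lower (x : R) : SL(2, R) := ⟨!![1, 0; x, 1], by simp [Matrix.det_fin_two]⟩

theorem ext_two {g h : SL(2, R)} (h00 : g.1 0 0 = h.1 0 0) (h01 : g.1 0 1 = h.1 0 1)
    (h10 : g.1 1 0 = h.1 1 0) (h11 : g.1 1 1 = h.1 1 1) : g = h := by
  apply Subtype.ext
  ext i j
  fin_cases i <;> fin_cases j <;> assumption

theorem det_eq_one_two (g : SL(2, R)) : g.1 0 0 * g.1 1 1 - g.1 0 1 * g.1 1 0 = 1 := by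
  rw [← Matrix.det_fin_two, g.2]

theorem val_mul_two (g h : SL(2, R)) (i j : Fin 2) :
    (g * h).1 i j = g.1 i 0 * h.1 0 j + g.1 i 1 * h.1 1 j := by
  change (g.1 * h.1) i j = _
  rw [Matrix.mul_apply, Fin.sum_univ_two]

/-- Diagonal matrices of determinant one. -/
def diagonalUnit (t : Rˣ) : SL(2, R) :=
  ⟨!![(t : R), 0; 0, ((t⁻¹ : Rˣ) : R)], by simp [Matrix.det_fin_two]⟩

/-- The diagonal torus. -/
def torus : Rˣ →* SL(2, R) where
  toFun := diagonalUnit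
  map_one' := by apply ext_two <;> simp [diagonalUnit]
  map_mul' s t := by
    apply ext_two <;> rw [val_mul_two] <;> simp [diagonalUnit, mul_comm]

theorem torus_val (t : Rˣ) : (torus t).1 = !![(t : R), 0; 0, ((t⁻¹ : Rˣ) : R)] := rfl

theorem upper_add (x y : R) : upper (x + y) = upper x * upper y := by
  apply ext_two <;> rw [val_mul_two] <;> simp [upper, add_comm]

theorem upper_zero : upper (0 : R) = 1 := by
  apply ext_two <;> simp [upper]

theorem lower_add (x y : R) : lower (x + y) = lower x * lower y := by
  apply ext_two <;> rw [val_mul_two] <;> simp [lower]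

theorem lower_zero : lower (0 : R) = 1 := by
  apply ext_two <;> simp [lower]

/-- The upper unipotent subgroup as a homomorphism. -/
def upperHom : Multiplicative R →* SL(2, R) where
  toFun x := upper x.toAdd
  map_one' := upper_zero
  map_mul' x y := upper_add x.toAdd y.toAdd

theorem upper_neg (x : R) : upper (-x) = (upper x)⁻¹ := by
  rw [eq_inv_iff_mul_eq_one, ← upper_add, neg_add_cancel, upper_zero]

theorem lower_neg (x : R) : lower (-x) = (lower x)⁻¹ := by
  rw [eq_inv_iff_mul_eq_one, ← lower_add, neg_add_cancel, lower_zero]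

theorem torus_mul_upper_mul_inv (t : Rˣ) (x : R) :
    torus t * upper x * (torus t)⁻¹ = upper ((t : R) ^ 2 * x) := by
  rw [mul_inv_eq_iff_eq_mul]
  apply ext_two <;> rw [val_mul_two, val_mul_two] <;> simp [upper, torus_val]
  rw [pow_two, mul_assoc, mul_assoc, mul_comm x, ← mul_assoc (t : R) _ x]
  simp

/-- The inverse of the transpose of a matrix. -/
def transposeInv (g : SL(2, R)) : SL(2, R) :=
  ⟨!![g.1 1 1, -g.1 1 0; -g.1 0 1, g.1 0 0], by
    have h := det_eq_one_two g
    rw [Matrix.det_fin_two]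
    simp only [Matrix.of_apply, Matrix.cons_val', Matrix.cons_val_zero, Matrix.cons_val_one,
      Matrix.cons_val_fin_one]
    linear_combination h⟩

/-- The inverse transpose automorphism, which exchanges upper and lower unipotents. -/
def invTranspose : SL(2, R) →* SL(2, R) where
  toFun := transposeInv
  map_one' := by apply ext_two <;> simp [transposeInv]
  map_mul' g h := by
    apply ext_two <;> rw [val_mul_two] <;> simp [transposeInv, -coe_mul, val_mul_two] <;> ring

theorem invTranspose_val (g : SL(2, R)) :
    (invTranspose g).1 = !![g.1 1 1, -g.1 1 0; -g.1 0 1, g.1 0 0] := rfl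

theorem invTranspose_invTranspose (g : SL(2, R)) : invTranspose (invTranspose g) = g := by
  apply ext_two <;> simp [invTranspose_val]

theorem invTranspose_upper (x : R) : invTranspose (upper x) = lower (-x) := by
  apply ext_two <;> rw [invTranspose_val] <;> simp [upper, lower]

/-- There are at most `|R|²` first rows. Among matrices sharing the first row of `g₀`, the second
row times `g₀⁻¹` has second coordinate the determinant `1`, so its first coordinate alone determines
the matrix. -/
theorem card_two_le [Finite R] : Nat.card SL(2, R) ≤ Nat.card R ^ 3 := by
  classical
  have := Fintype.ofFinite R
  rw [Nat.card_eq_fintype_card, Nat.card_eq_fintype_card, ← Finset.card_univ]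
  have h := Finset.card_le_mul_card_image (f := fun g : SL(2, R) => (g.1 0 0, g.1 0 1))
    Finset.univ (Fintype.card R) ?_
  · refine h.trans ((Nat.mul_le_mul_left _ (Finset.card_le_univ _)).trans ?_)
    rw [Fintype.card_prod]
    exact le_of_eq (by ring)
  · intro p hp
    obtain ⟨g₀, -, rfl⟩ := Finset.mem_image.1 hp
    rw [← Finset.card_univ]
    refine Finset.card_le_card_of_injOn
      (fun g => g.1 1 0 * g₀.1 1 1 - g.1 1 1 * g₀.1 1 0) (fun _ _ => Finset.mem_univ _) ?_
    intro g hg g' hg' he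
    simp only [Finset.coe_filter, Finset.mem_univ, true_and, Set.mem_ofPred_eq,
      Prod.mk.injEq] at hg hg' he
    have d0 := det_eq_one_two g₀
    have d1 := det_eq_one_two g
    have d2 := det_eq_one_two g'
    obtain ⟨ha, hb⟩ := hg
    obtain ⟨ha', hb'⟩ := hg'
    rw [ha, hb] at d1
    rw [ha', hb'] at d2
    refine ext_two (ha.trans ha'.symm) (hb.trans hb'.symm) ?_ ?_
    · linear_combination (g₀.1 0 0) * he + (g₀.1 1 0) * (d1 - d2) -
        (g.1 1 0 - g'.1 1 0) * d0
    · linear_combination (g₀.1 0 1) * he + (g₀.1 1 1) * (d1 - d2) -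
        (g.1 1 1 - g'.1 1 1) * d0

/-- A matrix congruent to `1` modulo `D * D'` with `a + b * (D' * z)` a unit is a product of five
unipotents, the upper ones with entries divisible by `D` and the lower ones by `D'`. -/
theorem eq_lower_upper_lower_upper_lower {D D' z : R} {g : SL(2, R)}
    (h00 : D * D' ∣ g.1 0 0 - 1) (h01 : D * D' ∣ g.1 0 1) (h10 : D * D' ∣ g.1 1 0)
    (hu : IsUnit (g.1 0 0 + g.1 0 1 * (D' * z))) :
    ∃ x₁ x₂ y₁ y₂ y₃ : R, g = lower (D' * y₁) * upper (D * x₁) * lower (D' * y₂) *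
      upper (D * x₂) * lower (D' * y₃) := by
  obtain ⟨a, ha⟩ := h00
  obtain ⟨b, hb⟩ := h01
  obtain ⟨c, hc⟩ := h10
  obtain ⟨u, hu⟩ := hu
  have hv : (u : R) * ((u⁻¹ : Rˣ) : R) = 1 := u.mul_inv
  set v : R := ((u⁻¹ : Rˣ) : R)
  set w : R := a + b * (D' * z)
  have hw : (u : R) = 1 + D * D' * w := by
    rw [hu, hb]
    linear_combination ha
  set c₁ : R := D * c + g.1 1 1 * z
  have hc₁ : g.1 1 0 + g.1 1 1 * (D' * z) = D' * c₁ := by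
    rw [hc]
    ring
  have hdet := det_eq_one_two g
  -- Right multiplication by `lower (D' * z)` turns the corner of `g` into the unit `u = 1 + D * D'
  -- * w`, which is the corner of `upper (D * w) * lower D'`. Dividing by `u`, one further upper
  -- factor and one lower factor correct the two off-diagonal entries.
  refine ⟨w, v * (D' * b - w), v * (c₁ - 1), 1, -z, ?_⟩
  rw [mul_neg, lower_neg, eq_mul_inv_iff_mul_eq]
  have hd1 : (u : R) * g.1 1 1 - g.1 0 1 * (D' * c₁) = 1 := by
    rw [← hc₁, hu]
    linear_combination hdet
  have cancel : ∀ p r : R, (u : R) * p = u * r → p = r := fun _ _ h => u.isUnit.mul_left_cancel h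
  apply ext_two <;> simp only [val_mul_two] <;>
    simp only [upper, lower, Matrix.of_apply, Matrix.cons_val', Matrix.cons_val_zero,
      Matrix.cons_val_one, Matrix.cons_val_fin_one]
  · linear_combination hw - hu
  · linear_combination hb + D * v * (D' * b - w) * hw - D * (D' * b - w) * hv
  · linear_combination hc₁ + D' * v * (c₁ - 1) * hw - D' * (c₁ - 1) * hv
  -- The last entry is forced by determinant one, since the corner `u` is invertible.
  · apply cancel
    have e₁ : D' * (v * (c₁ - 1)) * u = D' * (c₁ - 1) := by linear_combination D' * (c₁ - 1) * hv
    have e₂ : u * (D * (v * (D' * b - w))) = D * (D' * b - w) := by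
      linear_combination D * (D' * b - w) * hv
    linear_combination hd1 + D' * c₁ * hb +
      D' * (v * (c₁ - 1)) * u * (D * (v * (D' * b - w))) * hw -
      u * (D * (v * (D' * b - w))) * e₁ - D' * c₁ * e₂ - D * w * e₁ - hw

end Matrix.SpecialLinearGroup

/-! ### Comparing the divisor function with Euler's totient. -/

section Divisors

/-- Weight compensating for the primes at which `n.divisors.card ^ 2 * n ≤ φ n ^ 2` fails. -/
noncomputable def smallPrimeWeight (n : ℕ) : ℝ :=
  (if 2 ∣ n then 9 else 1) * (if 3 ∣ n then 3 else 1) * (if 5 ∣ n then 5 / 4 else 1)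

theorem smallPrimeWeight_le (n : ℕ) : smallPrimeWeight n ≤ 135 / 4 := by
  unfold smallPrimeWeight
  split_ifs <;> norm_num

theorem ite_dvd_mul_of_coprime {p a b : ℕ} (hp : p.Prime) (hab : a.Coprime b) (c : ℝ) :
    (if p ∣ a * b then c else 1) = (if p ∣ a then c else 1) * (if p ∣ b then c else 1) := by
  have : ¬ (p ∣ a ∧ p ∣ b) := fun h => hp.one_lt.ne'
    (Nat.dvd_one.1 (hab ▸ Nat.dvd_gcd h.1 h.2))
  by_cases ha : p ∣ a <;> by_cases hb : p ∣ b <;> simp_all [hp.dvd_mul]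

theorem smallPrimeWeight_mul {a b : ℕ} (hab : a.Coprime b) :
    smallPrimeWeight (a * b) = smallPrimeWeight a * smallPrimeWeight b := by
  unfold smallPrimeWeight
  rw [ite_dvd_mul_of_coprime Nat.prime_two hab, ite_dvd_mul_of_coprime Nat.prime_three hab,
    ite_dvd_mul_of_coprime Nat.prime_five hab]
  ring

/-- Raising `k` by one multiplies the right side by `p` and the left by `((k+2)/(k+1))²`, so the
inequality propagates once this ratio is at most `p`. -/
theorem sq_mul_sq_le_pow_mul {p c : ℝ} (hp : 2 ≤ p) {m : ℕ}
    (h0 : ((m : ℝ) + 1) ^ 2 * p ^ 2 ≤ c * p ^ m * (p - 1) ^ 2)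
    (hstep : ∀ k : ℕ, m ≤ k → ((k : ℝ) + 2) ^ 2 ≤ p * ((k : ℝ) + 1) ^ 2) {k : ℕ} (hk : m ≤ k) :
    ((k : ℝ) + 1) ^ 2 * p ^ 2 ≤ c * p ^ k * (p - 1) ^ 2 := by
  induction k, hk using Nat.le_induction with
  | base => exact h0
  | succ k hk ih =>
    push_cast
    calc ((k : ℝ) + 1 + 1) ^ 2 * p ^ 2 = ((k : ℝ) + 2) ^ 2 * p ^ 2 := by ring
      _ ≤ p * ((k : ℝ) + 1) ^ 2 * p ^ 2 := by gcongr; exact hstep k hk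
      _ = p * (((k : ℝ) + 1) ^ 2 * p ^ 2) := by ring
      _ ≤ p * (c * p ^ k * (p - 1) ^ 2) := by gcongr
      _ = _ := by ring

/-- The quotient to bound is `(k+1)² p² / (p^k (p-1)²)`. Its maximum over `k` is `9` for `p = 2` (at
`k = 2`), `3` for `p = 3`, `5/4` for `p = 5`, and is below `1` from `p = 7` on; these are the
weights. -/
theorem card_divisors_sq_mul_le_prime_pow {p k : ℕ} (hp : p.Prime) (hk : 0 < k) :
    ((p ^ k).divisors.card : ℝ) ^ 2 * (p ^ k : ℕ) ≤
      smallPrimeWeight (p ^ k) * ((p ^ k).totient : ℝ) ^ 2 := by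
  have hp2 : (2 : ℝ) ≤ p := by exact_mod_cast hp.two_le
  suffices h : ((k : ℝ) + 1) ^ 2 * (p : ℝ) ^ 2 ≤
      smallPrimeWeight (p ^ k) * (p : ℝ) ^ k * ((p : ℝ) - 1) ^ 2 by
    rw [Nat.divisors_prime_pow hp, Finset.card_map, Finset.card_range,
      Nat.totient_prime_pow hp hk]
    obtain ⟨m, rfl⟩ : ∃ m, k = m + 1 := ⟨k - 1, by omega⟩
    rw [Nat.add_sub_cancel]
    push_cast [Nat.cast_sub hp.one_lt.le] at h ⊢
    have hp0 : (0 : ℝ) < (p : ℝ) := by linarith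
    refine le_of_mul_le_mul_right ?_ hp0
    calc _ = (((m : ℝ) + 1 + 1) ^ 2 * (p : ℝ) ^ 2) * (p : ℝ) ^ m := by ring
      _ ≤ _ := mul_le_mul_of_nonneg_right h (by positivity)
      _ = _ := by ring
  have hq : ∀ r : ℕ, r.Prime → (r ∣ p ^ k ↔ r = p) := fun r hr =>
    ⟨fun h => (Nat.prime_dvd_prime_iff_eq hr hp).1 (hr.dvd_of_dvd_pow h),
      fun h => h ▸ dvd_pow_self r hk.ne'⟩
  simp only [smallPrimeWeight, hq 2 Nat.prime_two, hq 3 Nat.prime_three, hq 5 Nat.prime_five]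
  have step : ∀ j : ℕ, 2 ≤ j → ((j : ℝ) + 2) ^ 2 ≤ 2 * ((j : ℝ) + 1) ^ 2 := by
    intro j hj
    have : (2 : ℝ) ≤ j := by exact_mod_cast hj
    nlinarith
  have step' : ∀ (x : ℝ), 3 ≤ x → ∀ j : ℕ, 1 ≤ j →
      ((j : ℝ) + 2) ^ 2 ≤ x * ((j : ℝ) + 1) ^ 2 := by
    intro x hx j hj
    have : (1 : ℝ) ≤ j := by exact_mod_cast hj
    nlinarith
  have hk1 : 1 ≤ k := hk
  by_cases h2 : 2 = p
  · subst h2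
    -- For `p = 2` the induction step fails at `k = 1` (`9 > 8`), so it starts at `k = 2`.
    rcases hk1.eq_or_lt with rfl | hk2
    · norm_num
    · refine sq_mul_sq_le_pow_mul hp2 (by norm_num) (by simpa using step) hk2
  by_cases h3 : 3 = p
  · subst h3
    exact sq_mul_sq_le_pow_mul hp2 (by norm_num) (step' _ (by norm_num)) hk1
  by_cases h5 : 5 = p
  · subst h5
    exact sq_mul_sq_le_pow_mul hp2 (by norm_num) (step' _ (by norm_num)) hk1
  have h7 : 7 ≤ p := by
    have := hp.two_le
    by_contra! h
    interval_cases p <;> first | omega | (norm_num at hp)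
  have h7' : (7 : ℝ) ≤ p := by exact_mod_cast h7
  refine sq_mul_sq_le_pow_mul hp2 ?_ (step' _ (by linarith)) hk1
  simp only [h2, h3, h5, if_false]
  norm_num
  nlinarith

theorem card_divisors_sq_mul_le (n : ℕ) :
    (n.divisors.card : ℝ) ^ 2 * n ≤ 135 / 4 * (n.totient : ℝ) ^ 2 := by
  suffices h : (n.divisors.card : ℝ) ^ 2 * n ≤ smallPrimeWeight n * (n.totient : ℝ) ^ 2 from
    h.trans (mul_le_mul_of_nonneg_right (smallPrimeWeight_le n) (sq_nonneg _))
  induction n using Nat.recOnPosPrimePosCoprime with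
  | prime_pow p k hp hk => exact card_divisors_sq_mul_le_prime_pow hp hk
  | zero => simp
  | one => simp [smallPrimeWeight]
  | coprime a b _ _ hab iha ihb =>
    rw [hab.card_divisors_mul, smallPrimeWeight_mul hab, Nat.totient_mul hab]
    push_cast
    calc _ = ((a.divisors.card : ℝ) ^ 2 * a) * ((b.divisors.card : ℝ) ^ 2 * b) := by ring
      _ ≤ _ := mul_le_mul iha ihb (by positivity) (le_trans (by positivity) iha)
      _ = _ := by ring

end Divisors

/-! ### Counting in `ℤ/q`: square roots, residue classes, additive orders, units. -/

section ZModCounting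

/-- The congruence `x² = 1` has at most `2 τ(n)` solutions modulo `n`. -/
theorem card_sq_eq_one_le (n : ℕ) [NeZero n] :
    (Finset.univ.filter fun x : ZMod n => x ^ 2 = 1).card ≤ 2 * n.divisors.card := by
  -- Sort the solutions by `e = gcd(x - 1, n)`, a divisor of `n`. Then `n / e` divides `x + 1`, and
  -- two solutions with the same `e` differ by a root of `2y = 0`, of which there are at most two.
  set e : ZMod n → ℕ := fun x => ((x.val : ℤ) - 1).gcd n with he
  have hn := NeZero.ne n
  have hedvd : ∀ x, e x ∣ n := fun x => Int.natCast_dvd_natCast.1 (Int.gcd_dvd_right _ _)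
  refine (Finset.card_le_mul_card_image (f := e) _ 2 ?_).trans
    (Nat.mul_le_mul_left _ (Finset.card_le_card ?_))
  · intro g hg
    obtain ⟨x₀, hx₀, rfl⟩ := Finset.mem_image.1 hg
    have key : ∀ x : ZMod n, x ^ 2 = 1 → (n : ℤ) ∣ ((x.val : ℤ) - 1) * (x.val + 1) := by
      intro x hx
      rw [← ZMod.intCast_zmod_eq_zero_iff_dvd]
      push_cast
      rw [ZMod.natCast_zmod_val]
      linear_combination hx
    have hcof : ∀ x : ZMod n, x ^ 2 = 1 → ((n / e x : ℕ) : ℤ) ∣ (x.val : ℤ) + 1 := by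
      intro x hx
      have hen : ((e x : ℕ) : ℤ) * ((n / e x : ℕ) : ℤ) = n := by
        rw [← Nat.cast_mul, Nat.mul_div_cancel' (hedvd _)]
      have he0 : ((e x : ℕ) : ℤ) ≠ 0 := by
        intro h
        rw [h, zero_mul] at hen
        exact hn (by exact_mod_cast hen.symm)
      obtain ⟨w, hw⟩ := key x hx
      have hbez : ((e x : ℕ) : ℤ) = _ := Int.gcd_eq_gcd_ab ((x.val : ℤ) - 1) n
      refine ⟨w * Int.gcdA ((x.val : ℤ) - 1) n + Int.gcdB ((x.val : ℤ) - 1) n * (x.val + 1), ?_⟩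
      apply mul_left_cancel₀ he0
      rw [← mul_assoc, hen]
      linear_combination (x.val + 1 : ℤ) * hbez + Int.gcdA ((x.val : ℤ) - 1) n * hw
    refine le_trans ?_ (IsAddCyclic.card_nsmul_eq_zero_le (α := ZMod n) two_pos)
    refine Finset.card_le_card_of_injOn (fun x => x - x₀) ?_ fun x _ y _ h => sub_left_injective h
    intro x hx
    simp only [Finset.coe_filter, Finset.mem_filter, Finset.mem_univ, true_and,
      Set.mem_ofPred_eq] at hx hx₀ ⊢
    obtain ⟨hx, hex⟩ := hx
    have hen : ((e x₀ : ℕ) : ℤ) * ((n / e x₀ : ℕ) : ℤ) = n := by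
      rw [← Nat.cast_mul, Nat.mul_div_cancel' (hedvd _)]
    obtain ⟨s, hs⟩ := hcof x hx
    obtain ⟨s₀, hs₀⟩ := hcof x₀ hx₀
    obtain ⟨t, ht⟩ : ((e x : ℕ) : ℤ) ∣ (x.val : ℤ) - 1 := Int.gcd_dvd_left _ _
    obtain ⟨t₀, ht₀⟩ : ((e x₀ : ℕ) : ℤ) ∣ (x₀.val : ℤ) - 1 := Int.gcd_dvd_left _ _
    rw [hex] at hs ht
    have : (n : ℤ) ∣ 2 * ((x.val : ℤ) - x₀.val) := by
      -- Expand `2(x - x₀) = (x₀ + 1)(x - x₀) - (x₀ - 1)(x - x₀)`, using `x - x₀ = e(t - t₀)` in the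
      -- first term and `x - x₀ = (n/e)(s - s₀)` in the second.
      refine ⟨s₀ * (t - t₀) - t₀ * (s - s₀), ?_⟩
      rw [← hen]
      linear_combination ((x.val : ℤ) - x₀.val) * (hs₀ - ht₀) +
        ((n / e x₀ : ℕ) : ℤ) * s₀ * (ht - ht₀) - ((e x₀ : ℕ) : ℤ) * t₀ * (hs - hs₀)
    rw [← ZMod.intCast_zmod_eq_zero_iff_dvd] at this
    push_cast at this
    rw [ZMod.natCast_zmod_val, ZMod.natCast_zmod_val] at this
    simpa using this
  · intro g hg
    obtain ⟨x₀, -, rfl⟩ := Finset.mem_image.1 hg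
    rw [Nat.mem_divisors]
    exact ⟨hedvd _, hn⟩

theorem natCast_dvd_iff_castHom {q d : ℕ} [NeZero q] (hd : d ∣ q) (x : ZMod q) :
    (d : ZMod q) ∣ x ↔ ZMod.castHom hd (ZMod d) x = 0 := by
  constructor
  · rintro ⟨y, rfl⟩
    rw [map_mul, map_natCast, ZMod.natCast_self, zero_mul]
  · intro h
    rw [ZMod.castHom_apply, ZMod.cast_eq_val, ZMod.natCast_eq_zero_iff] at h
    obtain ⟨m, hm⟩ := h
    refine ⟨m, ?_⟩
    rw [← ZMod.natCast_zmod_val x, hm]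
    push_cast
    rfl

theorem card_filter_eq_le_card_filter_one {G M : Type*} [Group G] [Fintype G] [Group M]
    [DecidableEq M] (f : G →* M) (y : M) :
    (Finset.univ.filter fun g => f g = y).card ≤ (Finset.univ.filter fun g => f g = 1).card := by
  by_cases hy : y ∈ Set.range f
  · exact (MonoidHom.card_fiber_eq_of_mem_range f hy ⟨1, map_one f⟩).le
  · rw [Finset.filter_false_of_mem fun g _ h => hy ⟨g, h⟩]
    simp

theorem card_filter_one_mul_card {G M : Type*} [Group G] [Fintype G] [Group M] [Fintype M]
    [DecidableEq M] (f : G →* M) (hf : Function.Surjective f) :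
    (Finset.univ.filter fun g => f g = 1).card * Fintype.card M = Fintype.card G := by
  have h := Finset.card_eq_sum_card_fiberwise (s := (Finset.univ : Finset G)) (f := f)
    (t := Finset.univ) fun _ _ => Finset.mem_coe.2 (Finset.mem_univ _)
  rw [Finset.sum_congr rfl fun y _ =>
    MonoidHom.card_fiber_eq_of_mem_range f (hf y) ⟨1, map_one f⟩] at h
  rw [← Finset.card_univ (α := G), h]
  simp [mul_comm]

/-- The number of units of `ℤ/q` whose square lies in a given class modulo `d ∣ q`. -/
theorem card_units_sq_fiber_mul_le {q d : ℕ} [NeZero q] (hd : d ∣ q) (c : ZMod q) :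
    (Finset.univ.filter fun t : (ZMod q)ˣ => (d : ZMod q) ∣ (t : ZMod q) ^ 2 - c).card
      * d.totient ≤ q.totient * (2 * d.divisors.card) := by
  have : NeZero d := ⟨ne_zero_of_dvd_ne_zero (NeZero.ne q) hd⟩
  set S := Finset.univ.filter fun t : (ZMod q)ˣ => (d : ZMod q) ∣ (t : ZMod q) ^ 2 - c
  rcases S.eq_empty_or_nonempty with hS | ⟨t₀, ht₀⟩
  · simp [hS]
  set f : (ZMod q)ˣ →* (ZMod d)ˣ := ZMod.unitsMap hd
  set F : (ZMod q)ˣ →* (ZMod d)ˣ := (powMonoidHom 2).comp f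
  have hval : ∀ t : (ZMod q)ˣ, ((f t : (ZMod d)ˣ) : ZMod d) = ZMod.castHom hd (ZMod d) t :=
    fun t => rfl
  have h1 : S.card ≤ (Finset.univ.filter fun t => F t = 1).card := by
    refine le_trans (Finset.card_le_card fun t ht => ?_)
      (card_filter_eq_le_card_filter_one F (F t₀))
    simp only [S, Finset.mem_filter, Finset.mem_univ, true_and, natCast_dvd_iff_castHom hd,
      map_sub, map_pow, sub_eq_zero] at ht ht₀ ⊢
    apply Units.ext
    simp only [F, MonoidHom.comp_apply, powMonoidHom_apply, Units.val_pow_eq_pow_val, hval]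
    rw [ht, ht₀]
  -- The kernel of `t ↦ t² mod d` is fibred by reduction modulo `d` over the square roots of `1`.
  have h2 : (Finset.univ.filter fun t => F t = 1).card ≤
      (Finset.univ.filter fun t => f t = 1).card *
        (Finset.univ.filter fun s : (ZMod d)ˣ => s ^ 2 = 1).card := by
    rw [Finset.card_eq_sum_card_fiberwise (f := f)
      (t := Finset.univ.filter fun s : (ZMod d)ˣ => s ^ 2 = 1), mul_comm, ← smul_eq_mul]
    · refine Finset.sum_le_card_nsmul _ _ _ fun s _ => le_trans (Finset.card_le_card ?_)
        (card_filter_eq_le_card_filter_one f s)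
      intro t ht
      simp only [Finset.mem_filter, Finset.mem_univ, true_and] at ht ⊢
      exact ht.2
    · intro t ht
      simpa [F] using ht
  have h3 : (Finset.univ.filter fun s : (ZMod d)ˣ => s ^ 2 = 1).card ≤ 2 * d.divisors.card := by
    refine le_trans (Finset.card_le_card_of_injOn (fun s => (s : ZMod d)) ?_
      fun s _ t _ h => Units.ext h) (card_sq_eq_one_le d)
    intro s hs
    simp only [Finset.coe_filter, Finset.mem_univ, true_and, Set.mem_ofPred_eq] at hs ⊢
    rw [← Units.val_pow_eq_pow_val, hs, Units.val_one]
  have h4 := card_filter_one_mul_card f (ZMod.unitsMap_surjective hd)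
  rw [ZMod.card_units_eq_totient, ZMod.card_units_eq_totient] at h4
  calc _ ≤ ((Finset.univ.filter fun t => f t = 1).card * (2 * d.divisors.card)) * d.totient :=
        Nat.mul_le_mul_right _ (h1.trans (h2.trans (Nat.mul_le_mul_left _ h3)))
    _ = _ := by rw [← h4]; ring

/-- The number of elements of a class modulo `d ∣ q` in `ℤ/q`. -/
theorem card_class_mul_le {q d : ℕ} [NeZero q] (hd : d ∣ q) (c : ZMod q) :
    (Finset.univ.filter fun x : ZMod q => (d : ZMod q) ∣ x - c).card * d ≤ q := by
  have : NeZero d := ⟨ne_zero_of_dvd_ne_zero (NeZero.ne q) hd⟩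
  set f : Multiplicative (ZMod q) →* Multiplicative (ZMod d) :=
    AddMonoidHom.toMultiplicative (ZMod.castHom hd (ZMod d)).toAddMonoidHom
  have hf : Function.Surjective f := ZMod.castHom_surjective hd
  have h := card_filter_one_mul_card f hf
  rw [Fintype.card_multiplicative, Fintype.card_multiplicative, ZMod.card, ZMod.card] at h
  refine le_trans (Nat.mul_le_mul_right _ ?_) h.le
  refine le_trans (Finset.card_le_card_of_injOn Multiplicative.ofAdd ?_
    fun _ _ _ _ h => h) (card_filter_eq_le_card_filter_one f (f (Multiplicative.ofAdd c)))
  intro x hx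
  simp only [Finset.coe_filter, Finset.mem_univ, true_and, Set.mem_ofPred_eq,
    natCast_dvd_iff_castHom hd, map_sub, sub_eq_zero] at hx ⊢
  exact congrArg Multiplicative.ofAdd hx

/-- Telescoping, since `4n(n+1) ≤ (n+1)^4`. The constant `5/4` is chosen so that its cube is still
below `2`. -/
theorem sum_Icc_inv_pow_four_le (n : ℕ) (hn : 1 ≤ n) :
    ∑ r ∈ Finset.Icc 1 n, ((r : ℝ) ^ 4)⁻¹ ≤ 5 / 4 - 1 / (4 * n) := by
  induction n, hn using Nat.le_induction with
  | base => norm_num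
  | succ n hn ih =>
    rw [Finset.sum_Icc_succ_top (by omega)]
    have hn' : (1 : ℝ) ≤ n := by exact_mod_cast hn
    have h : (((n : ℝ) + 1) ^ 4)⁻¹ ≤ 1 / (4 * (n : ℝ)) - 1 / (4 * ((n : ℝ) + 1)) := by
      rw [show 1 / (4 * (n : ℝ)) - 1 / (4 * ((n : ℝ) + 1)) = (4 * (n : ℝ) * ((n : ℝ) + 1))⁻¹ by field_simp; ring]
      apply inv_anti₀ (by positivity)
      nlinarith [mul_nonneg (by linarith : (0 : ℝ) ≤ n + 1) (sq_nonneg ((n : ℝ) - 1)),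
        sq_nonneg ((n : ℝ) + 1), pow_pos (by linarith : (0 : ℝ) < n) 3,
        pow_pos (by linarith : (0 : ℝ) < n) 4]
    push_cast
    linarith

/-- Each order `r ∣ q` is attained `φ(r) ≤ r` times, which leaves a sum of `r⁻⁴`. -/
theorem sum_inv_addOrderOf_pow_le (q : ℕ) [NeZero q] :
    ∑ x : ZMod q, ((addOrderOf x : ℝ) ^ 5)⁻¹ ≤ 5 / 4 := by
  have hq : 0 < q := Nat.pos_of_ne_zero (NeZero.ne q)
  have hmaps : ∀ x ∈ (Finset.univ : Finset (ZMod q)), addOrderOf x ∈ q.divisors := fun x _ =>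
    Nat.mem_divisors.2 ⟨by simpa using addOrderOf_dvd_card (x := x), hq.ne'⟩
  rw [← Finset.sum_fiberwise_of_maps_to hmaps]
  calc _ ≤ ∑ r ∈ q.divisors, ((r : ℝ) ^ 4)⁻¹ := by
        refine Finset.sum_le_sum fun r hr => ?_
        have hr0 : (0 : ℝ) < r := by exact_mod_cast Nat.pos_of_mem_divisors hr
        rw [Finset.sum_congr rfl fun x hx => by rw [(Finset.mem_filter.1 hx).2],
          Finset.sum_const, IsAddCyclic.card_addOrderOf_eq_totient
          (by simpa using Nat.dvd_of_mem_divisors hr), nsmul_eq_mul, pow_succ, mul_inv, mul_comm,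
          mul_assoc]
        refine mul_le_of_le_one_right (by positivity) ?_
        rw [inv_mul_le_iff₀ hr0, mul_one]
        exact_mod_cast Nat.totient_le r
    _ ≤ ∑ r ∈ Finset.Icc 1 q, ((r : ℝ) ^ 4)⁻¹ := by
        refine Finset.sum_le_sum_of_subset_of_nonneg (fun r hr => ?_) fun _ _ _ => by positivity
        exact Finset.mem_Icc.2 ⟨Nat.pos_of_mem_divisors hr, Nat.divisor_le hr⟩
    _ ≤ 5 / 4 := (sum_Icc_inv_pow_four_le q hq).trans (by
        have : (0 : ℝ) ≤ 1 / (4 * q) := by positivity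
        linarith)

theorem sum_inv_addOrderOf_mul_pow_le {q : ℕ} [NeZero q] (m : ZMod q) :
    ∑ x : ZMod q, ((addOrderOf (x * m) : ℝ) ^ 5)⁻¹ ≤
      5 / 4 * (Finset.univ.filter fun x : ZMod q => x * m = 0).card := by
  set M := (Finset.univ.filter fun x : ZMod q => x * m = 0).card
  have hM : ∀ y : ZMod q, (Finset.univ.filter fun x : ZMod q => x * m = y).card ≤ M := by
    intro y
    rcases (Finset.univ.filter fun x : ZMod q => x * m = y).eq_empty_or_nonempty with h | ⟨x₀, hx₀⟩
    · simp [h]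
    · refine Finset.card_le_card_of_injOn (fun x => x - x₀) (fun x hx => ?_)
        fun x _ y _ h => sub_left_injective h
      simp only [Finset.coe_filter, Finset.mem_filter, Finset.mem_univ, true_and,
        Set.mem_ofPred_eq] at hx hx₀ ⊢
      rw [sub_mul, hx, hx₀, sub_self]
  rw [← Finset.sum_fiberwise_of_maps_to (g := fun x => x * m) (t := Finset.univ)
    fun _ _ => Finset.mem_univ _]
  calc _ ≤ ∑ y : ZMod q, (M : ℝ) * ((addOrderOf y : ℝ) ^ 5)⁻¹ := by
        refine Finset.sum_le_sum fun y _ => ?_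
        rw [Finset.sum_congr rfl fun x hx => by rw [(Finset.mem_filter.1 hx).2],
          Finset.sum_const, nsmul_eq_mul]
        gcongr
        exact hM y
    _ ≤ _ := by
        rw [← Finset.mul_sum, mul_comm]
        gcongr
        exact sum_inv_addOrderOf_pow_le q

/-- `ℤ/q` has stable range one. -/
theorem ZMod.exists_isUnit_add_mul {q : ℕ} [NeZero q] {a c : ZMod q} (h : IsCoprime a c) :
    ∃ z, IsUnit (a + c * z) := by
  -- With this `z`, every prime factor of `q` divides exactly one of `a` and `c * z`, hence not
  -- their sum.
  set z : ℕ := ∏ p ∈ q.primeFactors.filter fun p => ¬ p ∣ a.val, p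
  refine ⟨(z : ZMod q), ?_⟩
  have hcast : a + c * z = ((a.val + c.val * z : ℕ) : ZMod q) := by simp
  rw [hcast, ZMod.isUnit_iff_coprime]
  refine Nat.Coprime.symm (Nat.coprime_of_dvd fun p hp hpq hpa => ?_)
  by_cases ha : p ∣ a.val
  · have hpc : p ∣ c.val * z := (Nat.dvd_add_right ha).1 hpa
    have hc : p ∣ c.val := by
      refine (hp.dvd_mul.1 hpc).resolve_right fun hz => ?_
      obtain ⟨r, hr, hpr⟩ := (Prime.dvd_finsetProd_iff hp.prime _).1 hz
      rw [Finset.mem_filter] at hr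
      rw [(Nat.prime_dvd_prime_iff_eq hp (Nat.prime_of_mem_primeFactors hr.1)).1 hpr] at ha
      exact hr.2 ha
    have : Fact p.Prime := ⟨hp⟩
    obtain ⟨s, t, hst⟩ := h
    have hz : ∀ x : ZMod q, p ∣ x.val → ZMod.castHom hpq (ZMod p) x = 0 := fun x hx => by
      rwa [ZMod.castHom_apply, ZMod.cast_eq_val, ZMod.natCast_eq_zero_iff]
    have := congrArg (ZMod.castHom hpq (ZMod p)) hst
    rw [map_add, map_mul, map_mul, hz a ha, hz c hc, map_one, mul_zero, mul_zero,
      add_zero] at this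
    exact zero_ne_one this
  · have hz : p ∣ z := Finset.dvd_prod_of_mem _
      (Finset.mem_filter.2 ⟨Nat.mem_primeFactors.2 ⟨hp, hpq, NeZero.ne q⟩, ha⟩)
    exact ha ((Nat.dvd_add_left (hz.mul_left _)).1 hpa)

end ZModCounting

/-! ### Density increment on residue classes. -/

section DensityIncrement

variable {ι : Type*}

/-- The product ring `∏ i, ℤ / q i`. -/
abbrev ModProd (q : ι → ℕ) : Type _ := ∀ i, ZMod (q i)

variable {q : ι → ℕ}

/-- Coordinatewise congruence modulo `d`. -/
def CongMod (d : ι → ℕ) (x y : ModProd q) : Prop := ∀ i, (d i : ZMod (q i)) ∣ x i - y i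

theorem CongMod.symm {d : ι → ℕ} {x y : ModProd q} (h : CongMod d x y) : CongMod d y x :=
  fun i => by rw [← neg_sub]; exact (dvd_neg).2 (h i)

theorem CongMod.trans {d : ι → ℕ} {x y z : ModProd q} (h : CongMod d x y) (h' : CongMod d y z) :
    CongMod d x z :=
  fun i => by rw [← sub_add_sub_cancel (x i) (y i)]; exact dvd_add (h i) (h' i)

open Classical in
/-- The elements of `X` whose image under `f` is congruent to `c` modulo `d`. -/
noncomputable def classFilter {α : Type*} (X : Finset α) (f : α → ModProd q) (d : ι → ℕ)
    (c : ModProd q) : Finset α :=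
  X.filter fun x => CongMod d (f x) c

theorem mem_classFilter {α : Type*} {X : Finset α} {f : α → ModProd q} {d : ι → ℕ}
    {c : ModProd q} {x : α} : x ∈ classFilter X f d c ↔ x ∈ X ∧ CongMod d (f x) c := by
  classical
  rw [classFilter, Finset.mem_filter]

theorem prod_natCast_pos [Fintype ι] {r : ι → ℕ} (hr : ∀ i, r i ≠ 0) : (0 : ℝ) < ∏ i, (r i : ℝ) :=
  Finset.prod_pos fun i _ => by exact_mod_cast Nat.pos_of_ne_zero (hr i)

/-- A nonempty set has a dense piece in some residue class on which it does not concentrate any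
further. -/
theorem exists_density_increment [Fintype ι] [∀ i, NeZero (q i)] {α : Type*} {X : Finset α} (hX : X.Nonempty)
    (f : α → ModProd q) (σ : ℝ) :
    ∃ (d : ι → ℕ) (c : ModProd q), (∀ i, d i ∣ q i) ∧ (classFilter X f d c).Nonempty ∧
      (X.card : ℝ) ≤ (classFilter X f d c).card * (∏ i, (d i : ℝ)) ^ σ ∧
      ∀ r : ι → ℕ, (∀ i, d i * r i ∣ q i) → ∀ a : ModProd q,
        ((classFilter (classFilter X f d c) f (fun i => d i * r i) a).card : ℝ) *
          (∏ i, (r i : ℝ)) ^ σ ≤ (classFilter X f d c).card := by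
  classical
  set D : Finset ((ι → ℕ) × ModProd q) :=
    (Fintype.piFinset fun i => (q i).divisors) ×ˢ Finset.univ with hD
  have hmem : ∀ d c, (d, c) ∈ D ↔ ∀ i, d i ∣ q i := fun d c => by
    simp [hD, Fintype.mem_piFinset, Nat.mem_divisors, NeZero.ne]
  -- Choose the class maximizing its count times `(∏ d i) ^ σ`. Comparison with the trivial modulus
  -- gives the lower bound, and comparison with `d * r` gives non-concentration.
  obtain ⟨⟨d, c⟩, hdc, hmax⟩ := D.exists_max_image
    (fun p => ((classFilter X f p.1 p.2).card : ℝ) * (∏ i, (p.1 i : ℝ)) ^ σ)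
    ⟨(fun _ => 1, 0), (hmem _ _).2 fun i => one_dvd _⟩
  have hd := (hmem d c).1 hdc
  have hd0 : ∀ i, d i ≠ 0 := fun i => ne_zero_of_dvd_ne_zero (NeZero.ne _) (hd i)
  have hNd := prod_natCast_pos hd0
  have hone : (X.card : ℝ) ≤ (classFilter X f d c).card * (∏ i, (d i : ℝ)) ^ σ := by
    have h := hmax (fun _ => 1, 0) ((hmem _ _).2 fun i => one_dvd _)
    have hall : classFilter X f (fun _ => 1) 0 = X := by
      ext x
      simp [mem_classFilter, CongMod]
    simpa [hall] using h
  have hpos : 0 < (X.card : ℝ) := by exact_mod_cast hX.card_pos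
  refine ⟨d, c, hd, ?_, hone, ?_⟩
  · rw [← Finset.card_pos]
    have := pos_of_mul_pos_left (hpos.trans_le hone) (Real.rpow_nonneg hNd.le _)
    exact_mod_cast this
  · intro r hr a
    have h := hmax (fun i => d i * r i, a) ((hmem _ _).2 hr)
    have hr0 : ∀ i, r i ≠ 0 := fun i h0 => NeZero.ne (q i) (by simpa [h0] using hr i)
    have hNr := prod_natCast_pos hr0
    have hprod : ∏ i, ((d i * r i : ℕ) : ℝ) = (∏ i, (d i : ℝ)) * ∏ i, (r i : ℝ) := by
      push_cast
      exact Finset.prod_mul_distrib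
    simp only [hprod, Real.mul_rpow hNd.le hNr.le] at h
    have hsub : ((classFilter (classFilter X f d c) f (fun i => d i * r i) a).card : ℝ) ≤
        (classFilter X f (fun i => d i * r i) a).card := by
      refine Nat.cast_le.2 (Finset.card_le_card fun x hx => ?_)
      rw [mem_classFilter, mem_classFilter] at hx
      exact mem_classFilter.2 ⟨hx.1.1, hx.2⟩
    refine le_of_mul_le_mul_right ?_ (Real.rpow_pos_of_pos hNd σ)
    refine le_trans ?_ h
    calc _ = ((classFilter (classFilter X f d c) f (fun i => d i * r i) a).card : ℝ) *
          ((∏ i, (d i : ℝ)) ^ σ * (∏ i, (r i : ℝ)) ^ σ) := by ring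
      _ ≤ _ := mul_le_mul_of_nonneg_right hsub (by positivity)

end DensityIncrement

/-! ### Additive characters and the bilinear estimate. -/

section CharacterSums

variable {ι : Type*} [Fintype ι] (q : ι → ℕ) [∀ i, NeZero (q i)]

/-- The standard additive character of `∏ i, ℤ / q i`. -/
noncomputable def prodAddChar : AddChar (ModProd q) ℂ where
  toFun x := ∏ i, ZMod.stdAddChar (x i)
  map_zero_eq_one' := by simp
  map_add_eq_mul' x y := by simp [AddChar.map_add_eq_mul, Finset.prod_mul_distrib]

theorem prodAddChar_apply (x : ModProd q) : prodAddChar q x = ∏ i, ZMod.stdAddChar (x i) := rfl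

theorem prodAddChar_isPrimitive : (prodAddChar q).IsPrimitive := by
  classical
  intro a ha
  obtain ⟨i, hi⟩ := Function.ne_iff.1 ha
  obtain ⟨x, hx⟩ := AddChar.ne_one_iff.1 (ZMod.isPrimitive_stdAddChar (q i) hi)
  refine AddChar.ne_one_iff.2 ⟨Pi.single i x, ?_⟩
  rw [AddChar.mulShift_apply, prodAddChar_apply, Finset.prod_eq_single i]
  · simpa [AddChar.mulShift_apply] using hx
  · intro j _ hj
    simp [hj]
  · simp

theorem norm_prodAddChar (x : ModProd q) : ‖prodAddChar q x‖ = 1 := AddChar.norm_apply _ _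

theorem sum_prodAddChar_mul [DecidableEq ι] [DecidableEq (ModProd q)] (b : ModProd q) :
    ∑ x, prodAddChar q (x * b) = if b = 0 then (Fintype.card (ModProd q) : ℂ) else 0 := by
  rw [AddChar.sum_mulShift b (prodAddChar_isPrimitive q)]
  split_ifs <;> simp

variable {q}

/-- Multiplication by `r ∣ q` on `∏ ℤ / q i` has fibres of size at most `∏ r i`. -/
theorem card_filter_mul_eq_le [DecidableEq ι] [DecidableEq (ModProd q)] {r : ι → ℕ} (hr : ∀ i, r i ≠ 0)
    (w : ModProd q) :
    (Finset.univ.filter fun z : ModProd q => (fun i => (r i : ZMod (q i))) * z = w).card ≤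
      ∏ i, r i := by
  classical
  rcases (Finset.univ.filter fun z : ModProd q =>
    (fun i => (r i : ZMod (q i))) * z = w).eq_empty_or_nonempty with h | ⟨z₀, hz₀⟩
  · simp [h]
  calc _ ≤ (Fintype.piFinset fun i => Finset.univ.filter fun x : ZMod (q i) => r i • x = 0).card := by
        refine Finset.card_le_card_of_injOn (fun z => z - z₀) (fun z hz => ?_)
          fun x _ y _ h => sub_left_injective h
        simp only [Finset.coe_filter, Finset.mem_filter, Finset.mem_univ, true_and,
          Set.mem_ofPred_eq] at hz hz₀
        refine Finset.mem_coe.2 (Fintype.mem_piFinset.2 fun i => ?_)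
        have h1 := congrFun hz i
        have h2 := congrFun hz₀ i
        simp only [Pi.mul_apply] at h1 h2
        simp [nsmul_eq_mul, mul_sub, h1, h2]
    _ = ∏ i, (Finset.univ.filter fun x : ZMod (q i) => r i • x = 0).card :=
        Fintype.card_piFinset _
    _ ≤ ∏ i, r i := Finset.prod_le_prod' fun i _ =>
        IsAddCyclic.card_nsmul_eq_zero_le (Nat.pos_of_ne_zero (hr i))

theorem sum_sum_char_eq_norm_sq {α : Type*} (X : Finset α) (f : α → ModProd q)
    (η : ModProd q) :
    ∑ t ∈ X, ∑ t' ∈ X, prodAddChar q ((f t - f t') * η) =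
      ((‖∑ t ∈ X, prodAddChar q (f t * η)‖ ^ 2 : ℝ) : ℂ) := by
  push_cast
  rw [← Complex.mul_conj', map_sum, Finset.sum_mul_sum]
  refine Finset.sum_congr rfl fun t _ => Finset.sum_congr rfl fun t' _ => ?_
  rw [← AddChar.map_neg_eq_conj, ← AddChar.map_add_eq_mul]
  congr 1
  ring

/-- A multiple of `d` is killed by `n / d`. This makes `d` times the order an admissible modulus in
the non-concentration hypotheses. -/
theorem mul_addOrderOf_dvd {n d e : ℕ} [NeZero n] (x : ZMod n) (hd : d ∣ n) :
    d * addOrderOf (x * (d * e)) ∣ n := by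
  obtain ⟨m, rfl⟩ := hd
  refine Nat.mul_dvd_mul_left d (addOrderOf_dvd_of_nsmul_eq_zero ?_)
  have : ((d * m : ℕ) : ZMod (d * m)) = 0 := ZMod.natCast_self _
  push_cast at this
  rw [nsmul_eq_mul]
  linear_combination x * e * this

theorem dvd_of_mul_eq_zero {n d : ℕ} [NeZero n] (x m : ZMod n)
    (h : x * m = 0) : ((d * addOrderOf x : ℕ) : ZMod n) ∣ d * m := by
  have h' : addOrderOf x ∣ m.val := by
    apply addOrderOf_dvd_of_nsmul_eq_zero
    rw [nsmul_eq_mul, ZMod.natCast_zmod_val, mul_comm, h]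
  obtain ⟨k, hk⟩ := h'
  refine ⟨k, ?_⟩
  rw [← ZMod.natCast_zmod_val m, hk]
  push_cast
  ring

/-- The basic bilinear exponential sum estimate: if `f` on `X` is equidistributed inside a class
modulo `d`, and `B` inside a class modulo `e`, then the sum of a character over
`(f t - f t') * (b - b₀)` is small in terms of the order of the character on multiples of `d e`. -/
theorem norm_sum_char_le {α : Type*} {X : Finset α} {f : α → ModProd q} {B : Finset (ModProd q)}
    {d e : ι → ℕ} (hd : ∀ i, d i ∣ q i) (he : ∀ i, e i ∣ q i) {b₀ : ModProd q} {σ τ : ℝ}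
    (hX : ∀ t ∈ X, ∀ t' ∈ X, CongMod d (f t) (f t')) (hB : ∀ b ∈ B, CongMod e b b₀)
    (hXd : ∀ r : ι → ℕ, (∀ i, d i * r i ∣ q i) → ∀ a : ModProd q,
      ((classFilter X f (fun i => d i * r i) a).card : ℝ) * (∏ i, (r i : ℝ)) ^ σ ≤ X.card)
    (hBe : ∀ r : ι → ℕ, (∀ i, e i * r i ∣ q i) → ∀ a : ModProd q,
      ((classFilter B id (fun i => e i * r i) a).card : ℝ) * (∏ i, (r i : ℝ)) ^ τ ≤ B.card)
    (ξ : ModProd q) :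
    ‖∑ t ∈ X, ∑ t' ∈ X, ∑ b ∈ B, prodAddChar q (ξ * ((f t - f t') * (b - b₀)))‖ ≤
      (X.card : ℝ) ^ 2 * B.card *
        (∏ i, (addOrderOf (ξ i * (d i * e i)) : ℝ)) ^ (1 - σ - τ) := by
  classical
  set r : ι → ℕ := fun i => addOrderOf (ξ i * (d i * e i)) with hrdef
  -- The sum over `t, t'` is a square, so positivity allows the sum over `B` to be bounded by one
  -- over the whole ring. `F (E * y)` depends only on `y` modulo `r`, because the differences `f t -
  -- f t'` are multiples of `d`.
  set F : ModProd q → ℝ := fun β => ‖∑ t ∈ X, prodAddChar q (f t * (ξ * β))‖ ^ 2 with hF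
  have hF0 : ∀ β, 0 ≤ F β := fun β => sq_nonneg _
  set E : ModProd q := fun i => (e i : ZMod (q i))
  set P : ModProd q := fun i => (r i : ZMod (q i))
  have hr0 : ∀ i, r i ≠ 0 := fun i => (addOrderOf_pos _).ne'
  have hN : 0 < ∏ i, (r i : ℝ) := prod_natCast_pos hr0
  set N : ℝ := ∏ i, (r i : ℝ) with hNdef
  have hdr : ∀ i, d i * r i ∣ q i := fun i => mul_addOrderOf_dvd _ (hd i)
  have her : ∀ i, e i * r i ∣ q i := fun i => by
    have := mul_addOrderOf_dvd (e := d i) (ξ i) (he i)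
    rwa [mul_comm (e i : ZMod (q i))] at this
  have hcardR : (0 : ℝ) < Fintype.card (ModProd q) := by exact_mod_cast Fintype.card_pos
  -- reduction to a sum of squares
  have h1 : ∑ t ∈ X, ∑ t' ∈ X, ∑ b ∈ B, prodAddChar q (ξ * ((f t - f t') * (b - b₀))) =
      ((∑ b ∈ B, F (b - b₀) : ℝ) : ℂ) := by
    rw [Complex.ofReal_sum]
    simp_rw [Finset.sum_comm (s := X) (t := B)]
    refine Finset.sum_congr rfl fun b _ => ?_
    rw [hF, ← sum_sum_char_eq_norm_sq]
    refine Finset.sum_congr rfl fun t _ => Finset.sum_congr rfl fun t' _ => ?_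
    congr 1
    ring
  rw [h1, Complex.norm_of_nonneg (Finset.sum_nonneg fun b _ => hF0 _)]
  -- invariance of `F`
  have hinv : ∀ y z : ModProd q, F (E * (y + P * z)) = F (E * y) := by
    intro y z
    rcases X.eq_empty_or_nonempty with hXe | ⟨t₀, ht₀⟩
    · simp [hF, hXe]
    have : ∑ t ∈ X, prodAddChar q (f t * (ξ * (E * (y + P * z)))) =
        prodAddChar q (f t₀ * (ξ * (E * (P * z)))) *
          ∑ t ∈ X, prodAddChar q (f t * (ξ * (E * y))) := by
      rw [Finset.mul_sum]
      refine Finset.sum_congr rfl fun t ht => ?_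
      rw [← AddChar.map_add_eq_mul]
      congr 1
      have hz : (f t - f t₀) * (ξ * (E * (P * z))) = 0 := by
        funext i
        obtain ⟨m, hm⟩ := hX t ht t₀ ht₀ i
        have hri : (r i : ZMod (q i)) * (ξ i * (d i * e i)) = 0 := by
          rw [← nsmul_eq_mul]
          exact addOrderOf_nsmul_eq_zero _
        simp only [Pi.mul_apply, Pi.sub_apply, Pi.zero_apply, hm, E, P]
        linear_combination m * z i * hri
      linear_combination hz
    simp only [hF]
    rw [this, norm_mul, norm_prodAddChar, one_mul]
  have hy : ∀ b : ModProd q, ∃ y : ModProd q, b ∈ B → b - b₀ = E * y := by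
    intro b
    by_cases hb : b ∈ B
    · choose y hy using hB b hb
      exact ⟨y, fun _ => funext hy⟩
    · exact ⟨0, fun h => absurd h hb⟩
  choose y hy using hy
  -- averaging over the class
  have h2 : (Fintype.card (ModProd q) : ℝ) * ∑ b ∈ B, F (b - b₀) ≤
      (N * (B.card * N ^ (-τ))) * ∑ x : ModProd q, F (E * x) := by
    -- Solvability of `y b + P * z = x` puts `b` in a fixed class modulo `e * r`, which holds at
    -- most `|B| N ^ (-τ)` elements; each has at most `N` solutions `z`.
    have hcount : ∀ x : ModProd q, (∑ b ∈ B,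
        ((Finset.univ.filter fun z : ModProd q => P * z = x - y b).card : ℝ)) ≤
          N * (B.card * N ^ (-τ)) := by
      intro x
      have hsupp : ∀ b ∈ B, b ∉ classFilter B id (fun i => e i * r i) (b₀ + E * x) →
          ((Finset.univ.filter fun z : ModProd q => P * z = x - y b).card : ℝ) = 0 := by
        intro b hb hbn
        rw [Nat.cast_eq_zero, Finset.card_eq_zero, Finset.filter_eq_empty_iff]
        intro z _ hz
        refine hbn (mem_classFilter.2 ⟨hb, fun i => ⟨-z i, ?_⟩⟩)
        have hb' := congrFun (hy b hb) i
        have hz' := congrFun hz i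
        simp only [Pi.mul_apply, Pi.sub_apply, Pi.add_apply, id, E, P] at hb' hz' ⊢
        push_cast
        linear_combination hb' + e i * hz'
      rw [← Finset.sum_subset (fun b hb => (mem_classFilter.1 hb).1) hsupp]
      calc _ ≤ ∑ b ∈ classFilter B id (fun i => e i * r i) (b₀ + E * x), N :=
            Finset.sum_le_sum fun b _ => by
              rw [hNdef, ← Nat.cast_prod]
              exact_mod_cast card_filter_mul_eq_le hr0 _
        _ = N * (classFilter B id (fun i => e i * r i) (b₀ + E * x)).card := by
            rw [Finset.sum_const, nsmul_eq_mul, mul_comm]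
        _ ≤ _ := by
            refine mul_le_mul_of_nonneg_left ?_ hN.le
            rw [Real.rpow_neg hN.le, ← div_eq_mul_inv, le_div_iff₀ (Real.rpow_pos_of_pos hN τ)]
            exact hBe r her _
    calc (Fintype.card (ModProd q) : ℝ) * ∑ b ∈ B, F (b - b₀)
        = ∑ b ∈ B, ∑ z : ModProd q, F (E * (y b + P * z)) := by
          rw [Finset.mul_sum]
          refine Finset.sum_congr rfl fun b hb => ?_
          rw [Finset.sum_congr rfl fun z _ => hinv (y b) z, Finset.sum_const, Finset.card_univ,
            nsmul_eq_mul, hy b hb]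
      _ = ∑ b ∈ B, ∑ x : ModProd q,
            ((Finset.univ.filter fun z : ModProd q => P * z = x - y b).card : ℝ) * F (E * x) := by
          refine Finset.sum_congr rfl fun b _ => ?_
          rw [← Finset.sum_fiberwise_of_maps_to (g := fun z => y b + P * z) (t := Finset.univ)
            fun _ _ => Finset.mem_univ _]
          refine Finset.sum_congr rfl fun x _ => ?_
          rw [Finset.sum_congr rfl fun z hz => by rw [(Finset.mem_filter.1 hz).2],
            Finset.sum_const, nsmul_eq_mul]
          congr 3
          ext z
          simp only [Finset.mem_filter, Finset.mem_univ, true_and]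
          rw [eq_sub_iff_add_eq, add_comm]
      _ = ∑ x : ModProd q, (∑ b ∈ B,
            ((Finset.univ.filter fun z : ModProd q => P * z = x - y b).card : ℝ)) * F (E * x) := by
          rw [Finset.sum_comm]
          simp_rw [Finset.sum_mul]
      _ ≤ ∑ x : ModProd q, (N * (B.card * N ^ (-τ))) * F (E * x) :=
          Finset.sum_le_sum fun x _ => mul_le_mul_of_nonneg_right (hcount x) (hF0 _)
      _ = _ := by rw [Finset.mul_sum]
  -- orthogonality
  have h3 : ∑ x : ModProd q, F (E * x) ≤
      Fintype.card (ModProd q) * (X.card * (X.card * N ^ (-σ))) := by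
    have hc : ((∑ x : ModProd q, F (E * x) : ℝ) : ℂ) = ((∑ t ∈ X, ∑ t' ∈ X,
        if (f t - f t') * (ξ * E) = 0 then (Fintype.card (ModProd q) : ℝ) else 0 : ℝ) : ℂ) := by
      rw [Complex.ofReal_sum]
      simp only [hF]
      simp_rw [← sum_sum_char_eq_norm_sq]
      rw [Finset.sum_comm]
      push_cast
      refine Finset.sum_congr rfl fun t _ => ?_
      rw [Finset.sum_comm]
      refine Finset.sum_congr rfl fun t' _ => ?_
      have := sum_prodAddChar_mul q ((f t - f t') * (ξ * E))
      rw [apply_ite Complex.ofReal, Complex.ofReal_zero, Complex.ofReal_natCast, ← this]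
      refine Finset.sum_congr rfl fun x _ => ?_
      congr 1
      ring
    rw [Complex.ofReal_inj.1 hc]
    -- The surviving pairs have `f t ≡ f t'` modulo `d * r`, so each `t'` admits at most `|X| N ^
    -- (-σ)` values of `t`.
    calc _ ≤ ∑ t' ∈ X, (Fintype.card (ModProd q) : ℝ) * (X.card * N ^ (-σ)) := by
          rw [Finset.sum_comm]
          refine Finset.sum_le_sum fun t' ht' => ?_
          rw [← Finset.sum_filter, Finset.sum_const, nsmul_eq_mul, mul_comm]
          refine mul_le_mul_of_nonneg_left ?_ hcardR.le
          rw [Real.rpow_neg hN.le, ← div_eq_mul_inv, le_div_iff₀ (Real.rpow_pos_of_pos hN σ)]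
          refine le_trans ?_ (hXd r hdr (f t'))
          refine mul_le_mul_of_nonneg_right ?_ (Real.rpow_nonneg hN.le _)
          refine Nat.cast_le.2 (Finset.card_le_card fun t ht => ?_)
          rw [Finset.mem_filter] at ht
          refine mem_classFilter.2 ⟨ht.1, fun i => ?_⟩
          obtain ⟨m, hm⟩ := hX t ht.1 t' ht' i
          have hz := congrFun ht.2 i
          simp only [Pi.mul_apply, Pi.sub_apply, Pi.zero_apply, hm, E] at hz
          rw [hm]
          refine dvd_of_mul_eq_zero _ _ ?_
          linear_combination hz
      _ = _ := by
          rw [Finset.sum_const, nsmul_eq_mul]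
          ring
  refine le_of_mul_le_mul_left ?_ hcardR
  refine h2.trans ((mul_le_mul_of_nonneg_left h3 (by positivity)).trans (le_of_eq ?_))
  rw [show 1 - σ - τ = 1 + -σ + -τ by ring, Real.rpow_add hN, Real.rpow_add hN, Real.rpow_one]
  ring

end CharacterSums

/-! ### Covering all multiples of `d e` by the circle method. -/

section SumCover

theorem map_sum_eq_prod_of_addChar {M R κ : Type*} [AddCommMonoid M] [CommMonoid R]
    (ψ : AddChar M R) (s : Finset κ) (h : κ → M) : ψ (∑ j ∈ s, h j) = ∏ j ∈ s, ψ (h j) := by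
  classical
  induction s using Finset.induction_on with
  | empty => simp
  | insert a s ha ih => rw [Finset.sum_insert ha, Finset.prod_insert ha, AddChar.map_add_eq_mul, ih]

variable {ι : Type*} [Fintype ι] {q : ι → ℕ} [∀ i, NeZero (q i)]

/-- By orthogonality the left side is the size of the ring times the number of representations of
`w` as a `k`-fold sum. -/
theorem sum_char_mul_pow_eq_zero {Ω : Type*} [DecidableEq ι] {S : Finset Ω} {g : Ω → ModProd q}
    {k : ℕ} {w : ModProd q}
    (h : ∀ v : Fin k → Ω, (∀ j, v j ∈ S) → ∑ j, g (v j) ≠ w) :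
    ∑ ξ : ModProd q, prodAddChar q (-(ξ * w)) * (∑ ω ∈ S, prodAddChar q (ξ * g ω)) ^ k = 0 := by
  have hpow : ∀ ξ : ModProd q, prodAddChar q (-(ξ * w)) * (∑ ω ∈ S, prodAddChar q (ξ * g ω)) ^ k =
      ∑ v ∈ Fintype.piFinset fun _ : Fin k => S, prodAddChar q (ξ * (∑ j, g (v j) - w)) := by
    intro ξ
    have h1 := Finset.prod_univ_sum (fun _ : Fin k => S) fun _ ω => prodAddChar q (ξ * g ω)
    rw [Finset.prod_const, Finset.card_univ, Fintype.card_fin] at h1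
    rw [h1, Finset.mul_sum]
    refine Finset.sum_congr rfl fun v _ => ?_
    rw [mul_sub, sub_eq_add_neg, AddChar.map_add_eq_mul, mul_comm, Finset.mul_sum,
      map_sum_eq_prod_of_addChar]
  simp_rw [hpow]
  rw [Finset.sum_comm]
  refine Finset.sum_eq_zero fun v hv => ?_
  rw [sum_prodAddChar_mul, if_neg]
  exact sub_ne_zero.2 (h v fun j => Fintype.mem_piFinset.1 hv j)

theorem sum_prod_inv_addOrderOf_le [DecidableEq ι] (m : ModProd q) :
    ∑ ξ : ModProd q, ((∏ i, (addOrderOf (ξ i * m i) : ℝ)) ^ 5)⁻¹ ≤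
      (5 / 4) ^ Fintype.card ι *
        (Finset.univ.filter fun ξ : ModProd q => ξ * m = 0).card := by
  have h1 := Finset.prod_univ_sum (fun i => (Finset.univ : Finset (ZMod (q i))))
    fun i x => ((addOrderOf (x * m i) : ℝ) ^ 5)⁻¹
  rw [Fintype.piFinset_univ] at h1
  have h2 : (Finset.univ.filter fun ξ : ModProd q => ξ * m = 0) =
      Fintype.piFinset fun i => Finset.univ.filter fun x : ZMod (q i) => x * m i = 0 := by
    ext ξ
    simp [Fintype.mem_piFinset, funext_iff]
  calc _ = ∏ i, ∑ x : ZMod (q i), ((addOrderOf (x * m i) : ℝ) ^ 5)⁻¹ := by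
        rw [h1]
        refine Finset.sum_congr rfl fun ξ _ => ?_
        rw [← Finset.prod_pow, Finset.prod_inv_distrib]
    _ ≤ ∏ i, (5 / 4 * ((Finset.univ.filter fun x : ZMod (q i) => x * m i = 0).card : ℝ)) :=
        Finset.prod_le_prod (fun i _ => Finset.sum_nonneg fun _ _ => by positivity)
          fun i _ => sum_inv_addOrderOf_mul_pow_le (m i)
    _ = _ := by
        rw [Finset.prod_mul_distrib, Finset.prod_const, Finset.card_univ, h2,
          Fintype.card_piFinset, Nat.cast_prod]

/-- Ninety-fold sums of `(f t - f t') * (b - b₀)` cover all multiples of `d e`. -/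
theorem exists_sum_eq {α : Type*} {X : Finset α} {f : α → ModProd q} {B : Finset (ModProd q)}
    {d e : ι → ℕ} (hd : ∀ i, d i ∣ q i) (he : ∀ i, e i ∣ q i) {b₀ : ModProd q}
    (hι : (5 / 4 : ℝ) ^ Fintype.card ι < 2) (hXne : X.Nonempty) (hBne : B.Nonempty)
    (hX : ∀ t ∈ X, ∀ t' ∈ X, CongMod d (f t) (f t')) (hB : ∀ b ∈ B, CongMod e b b₀)
    (hXd : ∀ r : ι → ℕ, (∀ i, d i * r i ∣ q i) → ∀ a : ModProd q,
      ((classFilter X f (fun i => d i * r i) a).card : ℝ) *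
        (∏ i, (r i : ℝ)) ^ (1 / 5 : ℝ) ≤ X.card)
    (hBe : ∀ r : ι → ℕ, (∀ i, e i * r i ∣ q i) → ∀ a : ModProd q,
      ((classFilter B id (fun i => e i * r i) a).card : ℝ) *
        (∏ i, (r i : ℝ)) ^ (77 / 90 : ℝ) ≤ B.card)
    (y : ModProd q) :
    ∃ v : Fin 90 → α × α × ModProd q,
      (∀ j, (v j).1 ∈ X ∧ (v j).2.1 ∈ X ∧ (v j).2.2 ∈ B) ∧
      ∑ j, (f (v j).1 - f (v j).2.1) * ((v j).2.2 - b₀) =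
        (fun i => ((d i * e i : ℕ) : ZMod (q i))) * y := by
  classical
  set D : ModProd q := fun i => ((d i * e i : ℕ) : ZMod (q i)) with hD
  set S := X ×ˢ X ×ˢ B with hS
  set g : α × α × ModProd q → ModProd q := fun ω => (f ω.1 - f ω.2.1) * (ω.2.2 - b₀) with hg
  by_contra! hcon
  have hzero := sum_char_mul_pow_eq_zero (S := S) (g := g) (k := 90) (w := D * y)
    fun v hv => hcon v fun j => by simpa [hS] using hv j
  have hSpos : (0 : ℝ) < S.card := by
    exact_mod_cast Finset.card_pos.2 (hXne.product (hXne.product hBne))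
  set T : ModProd q → ℂ := fun ξ =>
    prodAddChar q (-(ξ * (D * y))) * (∑ ω ∈ S, prodAddChar q (ξ * g ω)) ^ 90 with hT
  set Z := Finset.univ.filter fun ξ : ModProd q => ξ * D = 0 with hZ
  set N : ModProd q → ℝ := fun ξ => ∏ i, (addOrderOf (ξ i * D i) : ℝ) with hN
  have hNpos : ∀ ξ, 0 < N ξ := fun ξ => prod_natCast_pos fun i => (addOrderOf_pos _).ne'
  have hgD : ∀ ω ∈ S, ∃ m, g ω = D * m := by
    rintro ⟨t, t', b⟩ hω
    simp only [hS, Finset.mem_product] at hω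
    choose m hm using hX t hω.1 t' hω.2.1
    choose n hn using hB b hω.2.2
    refine ⟨m * n, funext fun i => ?_⟩
    simp only [hg, hD, Pi.mul_apply, Pi.sub_apply, hm, hn]
    push_cast
    ring
  have hTZ : ∀ ξ ∈ Z, T ξ = (S.card : ℂ) ^ 90 := by
    intro ξ hξ
    have hξ' : ξ * D = 0 := (Finset.mem_filter.1 hξ).2
    simp only [hT]
    rw [← mul_assoc, hξ', zero_mul, neg_zero, AddChar.map_zero_eq_one, one_mul]
    congr 1
    rw [Finset.sum_congr rfl fun ω hω => by
      obtain ⟨m, hm⟩ := hgD ω hω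
      rw [hm, ← mul_assoc, hξ', zero_mul, AddChar.map_zero_eq_one]]
    simp
  have hNZ : ∀ ξ ∈ Z, N ξ = 1 := by
    intro ξ hξ
    have hξ' : ξ * D = 0 := (Finset.mem_filter.1 hξ).2
    refine Finset.prod_eq_one fun i _ => ?_
    have := congrFun hξ' i
    rw [Pi.mul_apply, Pi.zero_apply] at this
    rw [this, addOrderOf_zero, Nat.cast_one]
  -- The exponents are tuned so that `90 * (1 - 1/5 - 77/90) = -5`.
  have hTle : ∀ ξ, ‖T ξ‖ ≤ (S.card : ℝ) ^ 90 * ((N ξ) ^ 5)⁻¹ := by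
    intro ξ
    have h := norm_sum_char_le hd he hX hB hXd hBe ξ
    have hsum : ∑ ω ∈ S, prodAddChar q (ξ * g ω) =
        ∑ t ∈ X, ∑ t' ∈ X, ∑ b ∈ B, prodAddChar q (ξ * ((f t - f t') * (b - b₀))) := by
      rw [hS, Finset.sum_product]
      refine Finset.sum_congr rfl fun t _ => ?_
      rw [Finset.sum_product]
    have hNe : N ξ = ∏ i, (addOrderOf (ξ i * ((d i : ZMod (q i)) * e i)) : ℝ) := by
      simp only [hN, hD, Nat.cast_mul]
    rw [← hsum, ← hNe] at h
    have hScard : (X.card : ℝ) ^ 2 * B.card = S.card := by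
      rw [hS, Finset.card_product, Finset.card_product]
      push_cast
      ring
    rw [hScard] at h
    simp only [hT]
    rw [norm_mul, norm_prodAddChar, one_mul, norm_pow]
    refine (pow_le_pow_left₀ (norm_nonneg _) h 90).trans (le_of_eq ?_)
    rw [mul_pow, ← Real.rpow_natCast (N ξ ^ _), ← Real.rpow_mul (hNpos ξ).le,
      ← Real.rpow_natCast (N ξ) 5, ← Real.rpow_neg (hNpos ξ).le]
    norm_num
  have hsplit := Finset.sum_filter_add_sum_filter_not Finset.univ (fun ξ => ξ * D = 0) T
  rw [hzero, Finset.sum_congr rfl hTZ, Finset.sum_const, nsmul_eq_mul] at hsplit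
  have hnorm : (Z.card : ℝ) * (S.card : ℝ) ^ 90 ≤
      ∑ ξ ∈ Finset.univ.filter (fun ξ : ModProd q => ¬ ξ * D = 0),
        (S.card : ℝ) ^ 90 * ((N ξ) ^ 5)⁻¹ := by
    have h1 : ‖((Z.card : ℂ) * (S.card : ℂ) ^ 90)‖ = (Z.card : ℝ) * (S.card : ℝ) ^ 90 := by simp
    rw [← h1, eq_neg_of_add_eq_zero_left hsplit, norm_neg]
    exact norm_sum_le_of_le _ fun ξ _ => hTle ξ
  have hall := Finset.sum_filter_add_sum_filter_not Finset.univ (fun ξ => ξ * D = 0)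
    fun ξ => ((N ξ) ^ 5)⁻¹
  rw [Finset.sum_congr rfl fun ξ hξ => by rw [hNZ ξ hξ], Finset.sum_const] at hall
  have htot : ∑ ξ : ModProd q, ((N ξ) ^ 5)⁻¹ ≤ (5 / 4) ^ Fintype.card ι * (Z.card : ℝ) :=
    sum_prod_inv_addOrderOf_le D
  have hZpos : (0 : ℝ) < Z.card := by
    exact_mod_cast Finset.card_pos.2 ⟨0, by simp [hZ]⟩
  rw [← Finset.mul_sum] at hnorm
  -- Cancellation to zero needs the frequencies off `Z` to weigh at least `|Z|`. Those in `Z` weigh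
  -- exactly `|Z|`, while the total is below `2 |Z|`: a contradiction.
  have h2 : (Z.card : ℝ) ≤
      ∑ ξ ∈ Finset.univ.filter (fun ξ : ModProd q => ¬ ξ * D = 0), ((N ξ) ^ 5)⁻¹ := by
    refine le_of_mul_le_mul_left ?_ (pow_pos hSpos 90)
    linarith
  have h3 := mul_lt_mul_of_pos_right hι hZpos
  simp only [one_pow, inv_one, nsmul_eq_mul, mul_one] at hall
  linarith

end SumCover

/-! ### Generating large groups of unipotents. -/

section BoundedGeneration

open Matrix.SpecialLinearGroup

theorem card_class_prod_le {ι : Type*} [Fintype ι] [DecidableEq ι] {q : ι → ℕ}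
    [∀ i, NeZero (q i)] {d : ι → ℕ}
    (hd : ∀ i, d i ∣ q i) (B : Finset (ModProd q)) (c : ModProd q) :
    (classFilter B id d c).card * ∏ i, d i ≤ ∏ i, q i := by
  classical
  have h : classFilter B id d c ⊆ Fintype.piFinset fun i =>
      Finset.univ.filter fun x : ZMod (q i) => (d i : ZMod (q i)) ∣ x - c i := fun x hx =>
    Fintype.mem_piFinset.2 fun i => Finset.mem_filter.2
      ⟨Finset.mem_univ _, (mem_classFilter.1 hx).2 i⟩
  refine (Nat.mul_le_mul_right _ (Finset.card_le_card h)).trans ?_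
  rw [Fintype.card_piFinset, ← Finset.prod_mul_distrib]
  exact Finset.prod_le_prod' fun i _ => card_class_mul_le (hd i) (c i)

theorem card_sq_class_prod_le {ι : Type*} [Fintype ι] [DecidableEq ι] {q : ι → ℕ}
    [∀ i, NeZero (q i)] {d : ι → ℕ}
    (hd : ∀ i, d i ∣ q i) (X : Finset (ModProd q)ˣ) (c : ModProd q) :
    (classFilter X (fun t => (t : ModProd q) ^ 2) d c).card * ∏ i, (d i).totient ≤
      (∏ i, (q i).totient) * ∏ i, (2 * (d i).divisors.card) := by
  classical
  have h : (classFilter X (fun t => (t : ModProd q) ^ 2) d c).card ≤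
      (Fintype.piFinset fun i => Finset.univ.filter fun t : (ZMod (q i))ˣ =>
        (d i : ZMod (q i)) ∣ (t : ZMod (q i)) ^ 2 - c i).card := by
    refine Finset.card_le_card_of_injOn MulEquiv.piUnits (fun t ht => ?_)
      fun _ _ _ _ h => MulEquiv.piUnits.injective h
    refine Finset.mem_coe.2 (Fintype.mem_piFinset.2 fun i => Finset.mem_filter.2
      ⟨Finset.mem_univ _, ?_⟩)
    exact (mem_classFilter.1 ht).2 i
  refine (Nat.mul_le_mul_right _ h).trans ?_
  rw [Fintype.card_piFinset, ← Finset.prod_mul_distrib, ← Finset.prod_mul_distrib]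
  exact Finset.prod_le_prod' fun i _ => card_units_sq_fiber_mul_le (hd i) (c i)

theorem card_units_modProd {ι : Type*} [Fintype ι] (q : ι → ℕ) [∀ i, NeZero (q i)] :
    Nat.card (ModProd q)ˣ = ∏ i, (q i).totient := by
  rw [Nat.card_congr MulEquiv.piUnits.toEquiv, Nat.card_pi]
  exact Finset.prod_congr rfl fun i _ => by
    rw [Nat.card_eq_fintype_card, ZMod.card_units_eq_totient]

theorem card_modProd {ι : Type*} [Fintype ι] (q : ι → ℕ) :
    Nat.card (ModProd q) = ∏ i, q i := by
  rw [Nat.card_pi]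
  exact Finset.prod_congr rfl fun i _ => Nat.card_zmod _

/-- A dense set of triples of units has its squares equidistributed in some class of small index. -/
theorem exists_units_sq_increment {q : Fin 3 → ℕ} [∀ i, NeZero (q i)] {X : Finset (ModProd q)ˣ}
    {K : ℝ} (hK : 2 ≤ K) (hX : (Nat.card (ModProd q)ˣ : ℝ) ≤ K * X.card) :
    ∃ (d : Fin 3 → ℕ) (c : ModProd q), (∀ i, d i ∣ q i) ∧
      (classFilter X (fun t => (t : ModProd q) ^ 2) d c).Nonempty ∧
      (∏ i, (d i : ℝ)) ≤ K ^ 40 ∧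
      ∀ r : Fin 3 → ℕ, (∀ i, d i * r i ∣ q i) → ∀ a : ModProd q,
        ((classFilter (classFilter X (fun t => (t : ModProd q) ^ 2) d c)
          (fun t => (t : ModProd q) ^ 2) (fun i => d i * r i) a).card : ℝ) *
          (∏ i, (r i : ℝ)) ^ (1 / 5 : ℝ) ≤
            (classFilter X (fun t => (t : ModProd q) ^ 2) d c).card := by
  have hH : (0 : ℝ) < Nat.card (ModProd q)ˣ := by exact_mod_cast Nat.card_pos
  have hX0 : X.Nonempty := by
    rw [← Finset.card_pos]
    have := pos_of_mul_pos_right (hH.trans_le hX) (by linarith)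
    exact_mod_cast this
  obtain ⟨d, c, hd, hne, hle, hinc⟩ :=
    exists_density_increment hX0 (fun t => (t : ModProd q) ^ 2) (1 / 5)
  refine ⟨d, c, hd, hne, ?_, hinc⟩
  have hd0 : ∀ i, d i ≠ 0 := fun i => ne_zero_of_dvd_ne_zero (NeZero.ne _) (hd i)
  have hN := prod_natCast_pos hd0
  have hcount := card_sq_class_prod_le hd X c
  rw [← card_units_modProd q] at hcount
  have hxpos : (0 : ℝ) < (classFilter X (fun t => (t : ModProd q) ^ 2) d c).card := by
    exact_mod_cast hne.card_pos
  set x : ℝ := ((classFilter X (fun t => (t : ModProd q) ^ 2) d c).card : ℝ)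
  set N : ℝ := ∏ i, (d i : ℝ) with hNdef
  set h : ℝ := (Nat.card (ModProd q)ˣ : ℝ)
  set F : ℝ := ∏ i, ((d i).totient : ℝ) with hF
  have hFpos : 0 < F := prod_natCast_pos fun i => (Nat.totient_pos.2 (Nat.pos_of_ne_zero (hd0 i))).ne'
  have hcount' : x * F ≤ h * ∏ i, (2 * ((d i).divisors.card : ℝ)) := by
    have : ((_ : ℕ) : ℝ) ≤ ((_ : ℕ) : ℝ) := Nat.cast_le.2 hcount
    push_cast at this
    exact this
  have hdiv : (∏ i, (2 * ((d i).divisors.card : ℝ))) ^ 2 * N ≤ 135 ^ 3 * F ^ 2 := by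
    rw [← Finset.prod_pow, hNdef, ← Finset.prod_mul_distrib, hF, ← Finset.prod_pow]
    calc _ ≤ ∏ i, (135 * ((d i).totient : ℝ) ^ 2) := by
          refine Finset.prod_le_prod (fun i _ => by positivity) fun i _ => ?_
          have := card_divisors_sq_mul_le (d i)
          linarith
      _ = _ := by
          rw [Finset.prod_mul_distrib, Finset.prod_const]
          simp
  have h1 : x ^ 2 * N ≤ 135 ^ 3 * h ^ 2 := by
    refine le_of_mul_le_mul_right ?_ (pow_pos hFpos 2)
    calc x ^ 2 * N * F ^ 2 = (x * F) ^ 2 * N := by ring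
      _ ≤ (h * ∏ i, (2 * ((d i).divisors.card : ℝ))) ^ 2 * N := by gcongr
      _ = h ^ 2 * ((∏ i, (2 * ((d i).divisors.card : ℝ))) ^ 2 * N) := by ring
      _ ≤ h ^ 2 * (135 ^ 3 * F ^ 2) := by gcongr
      _ = _ := by ring
  have h2 : h ≤ K * (x * N ^ (1 / 5 : ℝ)) := hX.trans (by gcongr)
  set M : ℝ := N ^ (1 / 5 : ℝ) with hM
  have hMpos : 0 < M := Real.rpow_pos_of_pos hN _
  have hNM : N = M ^ 5 := by
    rw [hM, ← Real.rpow_natCast, ← Real.rpow_mul hN.le]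
    norm_num
  have h3 : M ^ 3 ≤ (K ^ 8) ^ 3 := by
    have h4 : x ^ 2 * M ^ 5 ≤ 135 ^ 3 * (K * (x * M)) ^ 2 := by
      rw [← hNM]
      exact h1.trans (by gcongr)
    have h5 : M ^ 3 ≤ 135 ^ 3 * K ^ 2 := by
      refine le_of_mul_le_mul_left ?_ (mul_pos (pow_pos hxpos 2) (pow_pos hMpos 2))
      linarith
    -- The assumption `2 ≤ K` serves to absorb the constant: `135 ^ 3 ≤ 2 ^ 22`.
    have h6 : (135 : ℝ) ^ 3 ≤ K ^ 22 := le_trans (by norm_num) (pow_le_pow_left₀ two_pos.le hK 22)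
    calc M ^ 3 ≤ 135 ^ 3 * K ^ 2 := h5
      _ ≤ K ^ 22 * K ^ 2 := by gcongr
      _ = _ := by ring
  have h7 : M ≤ K ^ 8 := le_of_pow_le_pow_left₀ three_ne_zero (by positivity) h3
  calc N = M ^ 5 := hNM
    _ ≤ (K ^ 8) ^ 5 := by gcongr
    _ = _ := by ring

/-- A dense subset of a product of three cyclic rings is equidistributed in some class of small
index. -/
theorem exists_class_increment {q : Fin 3 → ℕ} [∀ i, NeZero (q i)] {B : Finset (ModProd q)}
    {K : ℝ} (hK : 1 ≤ K) (hB : (Nat.card (ModProd q) : ℝ) ≤ K * B.card) :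
    ∃ (e : Fin 3 → ℕ) (c : ModProd q), (∀ i, e i ∣ q i) ∧
      (classFilter B id e c).Nonempty ∧ (∏ i, (e i : ℝ)) ≤ K ^ 7 ∧
      ∀ r : Fin 3 → ℕ, (∀ i, e i * r i ∣ q i) → ∀ a : ModProd q,
        ((classFilter (classFilter B id e c) id (fun i => e i * r i) a).card : ℝ) *
          (∏ i, (r i : ℝ)) ^ (77 / 90 : ℝ) ≤ (classFilter B id e c).card := by
  have hQ : (0 : ℝ) < Nat.card (ModProd q) := by exact_mod_cast Nat.card_pos
  have hB0 : B.Nonempty := by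
    rw [← Finset.card_pos]
    have := pos_of_mul_pos_right (hQ.trans_le hB) (by linarith)
    exact_mod_cast this
  obtain ⟨e, c, he, hne, hle, hinc⟩ := exists_density_increment hB0 id (77 / 90)
  refine ⟨e, c, he, hne, ?_, hinc⟩
  have he0 : ∀ i, e i ≠ 0 := fun i => ne_zero_of_dvd_ne_zero (NeZero.ne _) (he i)
  have hN := prod_natCast_pos he0
  have hcount := card_class_prod_le he B c
  rw [← card_modProd q] at hcount
  have hcount' : ((classFilter B id e c).card : ℝ) * ∏ i, (e i : ℝ) ≤ Nat.card (ModProd q) := by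
    exact_mod_cast hcount
  have hbpos : (0 : ℝ) < (classFilter B id e c).card := by exact_mod_cast hne.card_pos
  set b : ℝ := ((classFilter B id e c).card : ℝ)
  set N : ℝ := ∏ i, (e i : ℝ)
  set M : ℝ := N ^ (1 / 90 : ℝ) with hM
  have hMpos : 0 < M := Real.rpow_pos_of_pos hN _
  have hNM : N = M ^ 90 := by
    rw [hM, ← Real.rpow_natCast, ← Real.rpow_mul hN.le]
    norm_num
  have hNM' : N ^ (77 / 90 : ℝ) = M ^ 77 := by
    rw [hM, ← Real.rpow_natCast, ← Real.rpow_mul hN.le]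
    norm_num
  rw [hNM'] at hle
  have h1 : b * M ^ 90 ≤ K * (b * M ^ 77) := by
    rw [← hNM]
    exact hcount'.trans (hB.trans (by gcongr))
  have h2 : M ^ 13 ≤ K := by
    refine le_of_mul_le_mul_left ?_ (mul_pos hbpos (pow_pos hMpos 77))
    linarith
  rw [hNM]
  -- From `M ^ 13 ≤ K`, rounding the exponent `90/13` up to `7` replaces `M ^ 90` by `M ^ 91`, which
  -- needs `1 ≤ M`.
  rcases le_total M 1 with hM1 | hM1
  · exact (pow_le_one₀ hMpos.le hM1).trans (one_le_pow₀ hK)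
  · calc M ^ 90 ≤ M ^ 91 := pow_le_pow_right₀ hM1 (by norm_num)
      _ = (M ^ 13) ^ 7 := by ring
      _ ≤ K ^ 7 := by gcongr

theorem upper_sum_mem_pow {R : Type*} [CommRing R] {A : Set SL(2, R)} {m : ℕ} {k : ℕ}
    (x : Fin k → R) (hx : ∀ j, upper (x j) ∈ A ^ m) : upper (∑ j, x j) ∈ A ^ (m * k) := by
  induction k with
  | zero => simp [upper_zero]
  | succ k ih =>
    rw [Fin.sum_univ_castSucc, upper_add, Nat.mul_succ]
    exact mul_mem_pow_add (ih _ fun j => hx _) (hx _)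

/-- Write the entry as `t²(b - b₀) + t'²(b₀ - b)`. Each summand is a torus conjugate of a quotient
of two unipotents and costs `2 + 4 + 2 = 8` factors. -/
theorem upper_sq_sub_sq_mul_mem_pow {R : Type*} [CommRing R] {A : Set SL(2, R)} (hA : A⁻¹ = A)
    {t t' : Rˣ} {b b₀ : R} (ht : torus t ∈ A ^ 2) (ht' : torus t' ∈ A ^ 2)
    (hb : upper b ∈ A ^ 2) (hb₀ : upper b₀ ∈ A ^ 2) :
    upper (((t : R) ^ 2 - (t' : R) ^ 2) * (b - b₀)) ∈ A ^ 16 := by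
  have hinv : ∀ {g : SL(2, R)}, g ∈ A ^ 2 → g⁻¹ ∈ A ^ 2 := fun {g} hg => by
    rw [← inv_pow_eq_self hA 2]
    exact Set.inv_mem_inv.2 hg
  have hconj : ∀ {s : Rˣ} {x y : R}, torus s ∈ A ^ 2 → upper x ∈ A ^ 2 → upper y ∈ A ^ 2 →
      upper ((s : R) ^ 2 * (x - y)) ∈ A ^ 8 := by
    intro s x y hs hx hy
    rw [← torus_mul_upper_mul_inv, sub_eq_add_neg, upper_add, upper_neg]
    exact mul_mem_pow_add (m := 6) (mul_mem_pow_add (m := 2) (n := 4) hs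
      (mul_mem_pow_add (m := 2) hx (hinv hy))) (hinv hs)
  rw [show ((t : R) ^ 2 - (t' : R) ^ 2) * (b - b₀) =
    (t : R) ^ 2 * (b - b₀) + (t' : R) ^ 2 * (b₀ - b) by ring, upper_add]
  exact mul_mem_pow_add (m := 8) (hconj ht hb hb₀) (hconj ht' hb₀ hb)

/-- A dense symmetric set boundedly generates a large subgroup of the upper unipotents. -/
theorem exists_upper_mem_pow {q : Fin 3 → ℕ} [∀ i, NeZero (q i)] {A : Set SL(2, ModProd q)}
    (hA : A⁻¹ = A) {K : ℝ} (hK : 2 ≤ K) (hcard : (∏ i, (q i : ℝ)) ^ 3 ≤ K * A.ncard) :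
    ∃ D : Fin 3 → ℕ, (∀ i, D i ≠ 0) ∧ ∏ i, (D i : ℝ) ≤ K ^ 47 ∧
      ∀ y : ModProd q, upper ((fun i => (D i : ZMod (q i))) * y) ∈ A ^ 1440 := by
  classical
  have hA2 : A⁻¹ * A = A ^ 2 := by rw [hA, pow_two]
  have hq0 : ∀ i, q i ≠ 0 := fun i => NeZero.ne _
  have hQ : (0 : ℝ) < ∏ i, (q i : ℝ) := prod_natCast_pos hq0
  have hK0 : 0 < K := by linarith
  have hApos : (0 : ℝ) < A.ncard := pos_of_mul_pos_right ((pow_pos hQ 3).trans_le hcard) hK0.le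
  have hG : (Nat.card SL(2, ModProd q) : ℝ) ≤ K * A.ncard := by
    refine le_trans ?_ hcard
    have := card_two_le (R := ModProd q)
    rw [card_modProd] at this
    exact_mod_cast this
  -- The density `1/K` of `A` is inherited by the preimage of `A²` under any homomorphism.
  have dense : ∀ (H : Type) [Group H] [Finite H] (f : H →* SL(2, ModProd q)),
      ∃ X : Finset H, (∀ h ∈ X, f h ∈ A ^ 2) ∧ (Nat.card H : ℝ) ≤ K * X.card := by
    intro H _ _ f
    have := Fintype.ofFinite H
    refine ⟨{h | f h ∈ A ^ 2}.toFinset, fun h hh => by simpa using hh, ?_⟩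
    rw [← Set.ncard_eq_toFinset_card']
    have h := ncard_mul_card_le_preimage f A
    rw [hA2] at h
    have h' : (A.ncard : ℝ) * Nat.card H ≤
        ({h | f h ∈ A ^ 2}.ncard : ℝ) * Nat.card SL(2, ModProd q) := by exact_mod_cast h
    refine le_of_mul_le_mul_left ?_ hApos
    calc _ ≤ ({h | f h ∈ A ^ 2}.ncard : ℝ) * (K * A.ncard) :=
          h'.trans (by gcongr)
      _ = _ := by ring
  obtain ⟨X, hXA, hXcard⟩ := dense (ModProd q)ˣ torus
  obtain ⟨B, hBA, hBcard⟩ : ∃ B : Finset (ModProd q), (∀ b ∈ B, upper b ∈ A ^ 2) ∧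
      (Nat.card (ModProd q) : ℝ) ≤ K * B.card := dense (Multiplicative (ModProd q)) upperHom
  obtain ⟨d, c, hd, hXne, hdK, hXd⟩ := exists_units_sq_increment hK hXcard
  obtain ⟨e, c', he, hBne, heK, hBe⟩ := exists_class_increment (by linarith) hBcard
  obtain ⟨b₀, hb₀⟩ := hBne
  refine ⟨fun i => d i * e i, fun i => mul_ne_zero (ne_zero_of_dvd_ne_zero (hq0 i) (hd i))
    (ne_zero_of_dvd_ne_zero (hq0 i) (he i)), ?_, fun y => ?_⟩
  · push_cast
    rw [Finset.prod_mul_distrib]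
    calc _ ≤ K ^ 40 * K ^ 7 := by gcongr
      _ = _ := by ring
  · have hcong := (mem_classFilter.1 hb₀).2
    obtain ⟨v, hv, hsum⟩ := exists_sum_eq (f := fun t : (ModProd q)ˣ => (t : ModProd q) ^ 2)
      hd he (by rw [Fintype.card_fin]; norm_num) hXne ⟨b₀, hb₀⟩
      (fun t ht t' ht' => (mem_classFilter.1 ht).2.trans (mem_classFilter.1 ht').2.symm)
      (fun b hb => (mem_classFilter.1 hb).2.trans hcong.symm) hXd hBe y
    rw [← hsum]
    refine upper_sum_mem_pow (m := 16) (k := 90) _ fun j => ?_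
    obtain ⟨h1, h2, h3⟩ := hv j
    exact upper_sq_sub_sq_mul_mem_pow hA (hXA _ (mem_classFilter.1 h1).1)
      (hXA _ (mem_classFilter.1 h2).1) (hBA _ (mem_classFilter.1 h3).1)
      (hBA _ (mem_classFilter.1 hb₀).1)

end BoundedGeneration

/-! ### From unipotents to congruence subgroups. -/

section Assembly

open Matrix.SpecialLinearGroup

/-- The corner is coprime to its row neighbour by the determinant, and to `D'` because it is `1`
modulo `D * D'`. Stable range one then applies in each coordinate. -/
theorem exists_isUnit_add_mul_mul {ι : Type*} {q : ι → ℕ} [∀ i, NeZero (q i)]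
    (D D' : ModProd q) {g : SL(2, ModProd q)} (h : D * D' ∣ g.1 0 0 - 1) :
    ∃ z, IsUnit (g.1 0 0 + g.1 0 1 * (D' * z)) := by
  have key : ∀ i, ∃ z, IsUnit (g.1 0 0 i + g.1 0 1 i * D' i * z) := fun i => by
    refine ZMod.exists_isUnit_add_mul (IsCoprime.mul_right ?_ ?_)
    · have := congrFun (det_eq_one_two g) i
      simp only [Pi.sub_apply, Pi.mul_apply, Pi.one_apply] at this
      exact ⟨g.1 1 1 i, -g.1 1 0 i, by linear_combination this⟩
    · obtain ⟨m, hm⟩ := h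
      have := congrFun hm i
      simp only [Pi.sub_apply, Pi.mul_apply, Pi.one_apply] at this
      exact ⟨1, -(D i * m i), by linear_combination this⟩
  choose z hz using key
  refine ⟨z, Pi.isUnit_iff.2 fun i => ?_⟩
  simpa [mul_assoc] using hz i

/-- Bounded generation inside `SL₂` of a product of three cyclic rings. -/
theorem exists_congruence_mem_pow {q : Fin 3 → ℕ} [∀ i, NeZero (q i)] {A : Set SL(2, ModProd q)}
    (hA : A⁻¹ = A) {K : ℝ} (hK : 1 < K) (hcard : (∏ i, (q i : ℝ)) ^ 3 < K * A.ncard) :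
    ∃ D : Fin 3 → ℕ, (∀ i, D i ≠ 0) ∧ ∏ i, (D i : ℝ) < K ^ 96 ∧
      ∀ g : SL(2, ModProd q), CongMod D (g.1 0 0) 1 → CongMod D (g.1 0 1) 0 →
        CongMod D (g.1 1 0) 0 → g ∈ A ^ 7200 := by
  have hQ : (0 : ℝ) < ∏ i, (q i : ℝ) := prod_natCast_pos fun i => NeZero.ne _
  rcases lt_or_ge K 2 with hK2 | hK2
  · refine ⟨fun _ => 1, fun _ => one_ne_zero, ?_, fun g _ _ _ => ?_⟩
    · simpa using one_lt_pow₀ hK (by norm_num : 96 ≠ 0)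
    · have hlt : Nat.card SL(2, ModProd q) < 2 * A.ncard := by
        have h1 := card_two_le (R := ModProd q)
        rw [card_modProd] at h1
        have h2 : ((Nat.card SL(2, ModProd q) : ℕ) : ℝ) ≤ (∏ i, (q i : ℝ)) ^ 3 := by
          exact_mod_cast h1
        have h3 : K * A.ncard ≤ 2 * A.ncard := by gcongr
        exact_mod_cast (h2.trans_lt hcard).trans_le h3
      have huniv := mul_inv_eq_univ_of_card_lt hlt
      rw [hA, ← pow_two] at huniv
      rw [show 7200 = 2 * 3600 by norm_num, pow_mul, huniv, Set.univ_pow (by norm_num)]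
      exact Set.mem_univ _
  · obtain ⟨D, hD0, hDK, hD⟩ := exists_upper_mem_pow hA hK2 hcard.le
    -- The image of `A` under inverse transpose satisfies the same hypotheses; its upper unipotents
    -- are the lower unipotents of `A`.
    have hA' : (invTranspose '' A)⁻¹ = invTranspose '' A := by
      rw [← Set.image_inv, hA]
    have hinj : Function.Injective (invTranspose (R := ModProd q)) :=
      Function.LeftInverse.injective invTranspose_invTranspose
    obtain ⟨D', hD0', hDK', hD'⟩ := exists_upper_mem_pow hA' hK2 (by
      rw [Set.ncard_image_of_injective _ hinj]
      exact hcard.le)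
    have hlower : ∀ y : ModProd q, lower ((fun i => (D' i : ZMod (q i))) * y) ∈ A ^ 1440 := by
      intro y
      have h := Set.mem_image_of_mem invTranspose (hD' (-y))
      rw [Set.image_pow, Set.image_image] at h
      simpa [invTranspose_invTranspose, invTranspose_upper] using h
    refine ⟨fun i => D i * D' i, fun i => mul_ne_zero (hD0 i) (hD0' i), ?_, fun g h00 h01 h10 => ?_⟩
    · push_cast
      rw [Finset.prod_mul_distrib]
      calc _ ≤ K ^ 47 * K ^ 47 := by
            gcongr
        _ = K ^ 94 := by ring
        _ < K ^ 96 := pow_lt_pow_right₀ hK (by norm_num)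
    · have hdvd : ∀ x y : ModProd q, CongMod (fun i => D i * D' i) x y →
          (fun i => (D i : ZMod (q i))) * (fun i => (D' i : ZMod (q i))) ∣ x - y := by
        intro x y h
        choose m hm using h
        refine ⟨m, funext fun i => ?_⟩
        simpa using hm i
      have h00 := hdvd _ _ h00
      have h01 := hdvd _ _ h01
      have h10 := hdvd _ _ h10
      rw [sub_zero] at h01 h10
      obtain ⟨z, hz⟩ := exists_isUnit_add_mul_mul _ _ h00
      obtain ⟨x₁, x₂, y₁, y₂, y₃, rfl⟩ := eq_lower_upper_lower_upper_lower h00 h01 h10 hz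
      exact mul_mem_pow_add (m := 5760) (mul_mem_pow_add (m := 4320) (mul_mem_pow_add (m := 2880)
        (mul_mem_pow_add (m := 1440) (hlower _) (hD _)) (hlower _)) (hD _)) (hlower _)

/-- The element of `SL₂(∏ ℤ/q i)` with given components. -/
def piSpecialLinear {ι : Type*} {q : ι → ℕ} (P : ∀ i, SL(2, ZMod (q i))) : SL(2, ModProd q) :=
  ⟨Matrix.of fun a b i => (P i).1 a b, by
    rw [Matrix.det_fin_two]
    funext i
    exact det_eq_one_two (P i)⟩

/-- The projection of `SL₂(∏ ℤ/q i)` to its three factors. -/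
def tripleProj (q : Fin 3 → ℕ) :
    SL(2, ModProd q) →* SL(2, ZMod (q 0)) × SL(2, ZMod (q 1)) × SL(2, ZMod (q 2)) :=
  (Matrix.SpecialLinearGroup.map (Pi.evalRingHom (fun i => ZMod (q i)) 0)).prod
    ((Matrix.SpecialLinearGroup.map (Pi.evalRingHom (fun i => ZMod (q i)) 1)).prod
      (Matrix.SpecialLinearGroup.map (Pi.evalRingHom (fun i => ZMod (q i)) 2)))

theorem tripleProj_piSpecialLinear {q : Fin 3 → ℕ} (P : ∀ i, SL(2, ZMod (q i))) :
    tripleProj q (piSpecialLinear P) = (P 0, P 1, P 2) := rfl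

theorem exists_components {q : Fin 3 → ℕ}
    (x : SL(2, ZMod (q 0)) × SL(2, ZMod (q 1)) × SL(2, ZMod (q 2))) :
    ∃ P : ∀ i, SL(2, ZMod (q i)), (P 0, P 1, P 2) = x :=
  ⟨fun i => match i with
    | 0 => x.1
    | 1 => x.2.1
    | 2 => x.2.2, rfl⟩

theorem tripleProj_surjective (q : Fin 3 → ℕ) : Function.Surjective (tripleProj q) := fun x => by
  obtain ⟨P, rfl⟩ := exists_components x
  exact ⟨piSpecialLinear P, tripleProj_piSpecialLinear P⟩

/-- By Bézout `gcd(D, q)` is a multiple of `D` modulo `q`. The modulus `D` found above need not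
divide `q`, and the gcd is the divisor replacing it. -/
theorem natCast_dvd_of_gcd_dvd {D q : ℕ} {n : ℤ} (h : ((D.gcd q : ℕ) : ℤ) ∣ n) :
    (D : ZMod q) ∣ (n : ZMod q) := by
  obtain ⟨m, rfl⟩ := h
  rw [Nat.gcd_eq_gcd_ab]
  push_cast
  rw [ZMod.natCast_self, zero_mul, add_zero, mul_assoc]
  exact dvd_mul_right _ _

theorem dvd_of_mem_principalCongruence {D q : ℕ} {g : SL(2, ZMod q)}
    (hg : g ∈ principalCongruence (D.gcd q) q) :
    (D : ZMod q) ∣ g.1 0 0 - 1 ∧ (D : ZMod q) ∣ g.1 0 1 ∧ (D : ZMod q) ∣ g.1 1 0 := by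
  obtain ⟨γ, hγ, rfl⟩ := hg
  obtain ⟨h00, h01, h10, -⟩ := CongruenceSubgroup.Gamma_mem.1 hγ
  refine ⟨?_, ?_, ?_⟩
  · have : ((D.gcd q : ℕ) : ℤ) ∣ γ.1 0 0 - 1 := by
      rw [← ZMod.intCast_zmod_eq_zero_iff_dvd]
      push_cast
      rw [h00, sub_self]
    simpa using natCast_dvd_of_gcd_dvd this
  · simpa using natCast_dvd_of_gcd_dvd ((ZMod.intCast_zmod_eq_zero_iff_dvd _ _).1 h01)
  · simpa using natCast_dvd_of_gcd_dvd ((ZMod.intCast_zmod_eq_zero_iff_dvd _ _).1 h10)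

theorem bounded_generation (q : Fin 3 → ℕ) (hq : ∀ i, 0 < q i) {δ : ℝ} (hδ : 0 < δ)
    (A : Set (SL(2, ZMod (q 0)) × SL(2, ZMod (q 1)) × SL(2, ZMod (q 2)))) (hsymm : A⁻¹ = A)
    (hcard : ((q 0 : ℝ) * q 1 * q 2) ^ (3 - δ) < (A.ncard : ℝ)) :
    ∃ q₁' q₂' q₃' : ℕ, q₁' ∣ q 0 ∧ q₂' ∣ q 1 ∧ q₃' ∣ q 2 ∧
      (q₁' : ℝ) * q₂' * q₃' < ((q 0 : ℝ) * q 1 * q 2) ^ (96 * δ) ∧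
      (principalCongruence q₁' (q 0) : Set SL(2, ZMod (q 0))) ×ˢ
          (principalCongruence q₂' (q 1) : Set SL(2, ZMod (q 1))) ×ˢ
          (principalCongruence q₃' (q 2) : Set SL(2, ZMod (q 2))) ⊆ A ^ 7200 := by
  have : ∀ i, NeZero (q i) := fun i => ⟨(hq i).ne'⟩
  have hQe : (q 0 : ℝ) * q 1 * q 2 = ∏ i, (q i : ℝ) := by
    rw [Fin.prod_univ_three]
  rw [hQe] at hcard ⊢
  have hQ1 : (1 : ℝ) ≤ ∏ i, (q i : ℝ) := by
    exact_mod_cast Nat.one_le_iff_ne_zero.2 (Finset.prod_ne_zero_iff.2 fun i _ => (hq i).ne')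
  have hQ0 : (0 : ℝ) < ∏ i, (q i : ℝ) := one_pos.trans_le hQ1
  set A₀ : Set SL(2, ModProd q) := tripleProj q ⁻¹' A with hA₀
  have himage : tripleProj q '' A₀ = A := Set.image_preimage_eq _ (tripleProj_surjective q)
  have hncard : A.ncard ≤ A₀.ncard := by
    rw [← himage]
    exact Set.ncard_image_le A₀.toFinite
  have hsymm₀ : A₀⁻¹ = A₀ := by
    ext g
    rw [Set.mem_inv, hA₀, Set.mem_preimage, Set.mem_preimage, map_inv, ← Set.mem_inv, hsymm]
  set K : ℝ := (∏ i, (q i : ℝ)) ^ δ with hKdef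
  have hcardK : (∏ i, (q i : ℝ)) ^ 3 < K * A₀.ncard := by
    have h1 : (∏ i, (q i : ℝ)) ^ 3 = K * (∏ i, (q i : ℝ)) ^ (3 - δ) := by
      rw [hKdef, ← Real.rpow_add hQ0, ← Real.rpow_natCast]
      norm_num
    rw [h1]
    refine mul_lt_mul_of_pos_left (hcard.trans_le ?_) (Real.rpow_pos_of_pos hQ0 _)
    exact_mod_cast hncard
  -- If the product of the moduli were `1`, the group would be trivial, while the hypothesis forces
  -- more than one element.
  have hK : 1 < K := by
    refine Real.one_lt_rpow (lt_of_le_of_ne hQ1 fun h => ?_) hδ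
    rw [hKdef, ← h, one_pow, Real.one_rpow, one_mul] at hcardK
    have h2 : A₀.ncard ≤ 1 := by
      refine (Set.ncard_le_card A₀).trans (card_two_le.trans ?_)
      rw [card_modProd, show ∏ i, q i = 1 by exact_mod_cast h.symm, one_pow]
    exact absurd hcardK (not_lt.2 (by exact_mod_cast h2))
  obtain ⟨D, hD0, hDK, hD⟩ := exists_congruence_mem_pow hsymm₀ hK hcardK
  refine ⟨(D 0).gcd (q 0), (D 1).gcd (q 1), (D 2).gcd (q 2), Nat.gcd_dvd_right _ _,
    Nat.gcd_dvd_right _ _, Nat.gcd_dvd_right _ _, ?_, ?_⟩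
  · have hle : ∀ i, (D i).gcd (q i) ≤ D i := fun i =>
      Nat.gcd_le_left _ (Nat.pos_of_ne_zero (hD0 i))
    rw [Fin.prod_univ_three] at hDK
    calc _ ≤ (D 0 : ℝ) * D 1 * D 2 := by
          gcongr <;> exact hle _
      _ < K ^ 96 := hDK
      _ = _ := by
          rw [hKdef, ← Real.rpow_natCast, ← Real.rpow_mul hQ0.le]
          norm_num [mul_comm]
  · rintro x ⟨h0, h1, h2⟩
    obtain ⟨P, rfl⟩ := exists_components x
    have hP : ∀ i, (D i : ZMod (q i)) ∣ (P i).1 0 0 - 1 ∧ (D i : ZMod (q i)) ∣ (P i).1 0 1 ∧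
        (D i : ZMod (q i)) ∣ (P i).1 1 0 := fun i => by
      match i with
      | 0 => exact dvd_of_mem_principalCongruence h0
      | 1 => exact dvd_of_mem_principalCongruence h1
      | 2 => exact dvd_of_mem_principalCongruence h2
    have hmem := Set.mem_image_of_mem (tripleProj q) (hD (piSpecialLinear P)
      (fun i => (hP i).1)
      (fun i => (sub_zero ((P i).1 0 1)).symm ▸ (hP i).2.1)
      (fun i => (sub_zero ((P i).1 1 0)).symm ▸ (hP i).2.2))
    rwa [Set.image_pow, himage, tripleProj_piSpecialLinear] at hmem

end Assembly

theorem proposition3p1 (δ : ℝ) (hδ : 0 < δ) (hδ' : δ < 1 / 40)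
    (q₁ q₂ q₃ : ℕ) (hq₁ : 0 < q₁) (hq₂ : 0 < q₂) (hq₃ : 0 < q₃)
    (A : Set (SL(2, ZMod q₁) × SL(2, ZMod q₂) × SL(2, ZMod q₃)))
    (hsymm : A⁻¹ = A)
    (hcard : ((q₁ : ℝ) * q₂ * q₃) ^ (3 - δ) < (A.ncard : ℝ)) :
    ∃ q₁' q₂' q₃' : ℕ, q₁' ∣ q₁ ∧ q₂' ∣ q₂ ∧ q₃' ∣ q₃ ∧
      (q₁' : ℝ) * q₂' * q₃' < ((q₁ : ℝ) * q₂ * q₃) ^ (96 * δ) ∧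
      (principalCongruence q₁' q₁ : Set SL(2, ZMod q₁)) ×ˢ
          (principalCongruence q₂' q₂ : Set SL(2, ZMod q₂)) ×ˢ
          (principalCongruence q₃' q₃ : Set SL(2, ZMod q₃)) ⊆ A ^ 7200 := by
  have hq : ∀ i, 0 < (![q₁, q₂, q₃] : Fin 3 → ℕ) i := by
    intro i
    fin_cases i <;> assumption
  exact bounded_generation ![q₁, q₂, q₃] hq hδ A hsymm hcard
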